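/- Let $M$ be a smooth surface, $\mathcal TM$ its bundle of nonzero tangent vectors, and let $F:TM\to\mathbb R$ be a Finsler function: continuous on $TM$; smooth and positive on $\mathcal TM$; positively homogeneous of degree $1$ in the fibre variable; with $g_{ij}=\partial^2E/\partial y^i\partial y^j$, $E=\tfrac12F^2$, nondegenerate on $\mathcal TM$. Let $S=y^i\frac{\partial}{\partial x^i}-2G^i\frac{\partial}{\partial y^i}$ be its geodesic spray, $G^i=\tfrac12 g^{ij}\big(y^k\frac{\partial^2E}{\partial x^k\partial y^j}-\frac{\partial E}{\partial x^j}\big)$, and put $G^i_j=\partial G^i/\partial y^j$, $\frac{\delta}{\delta x^i}=\frac{\partial}{\partial x^i}-G^j_i\frac{\partial}{\partial y^j}$, and $R^i_j=2\frac{\partial G^i}{\partial x^j}-S(G^i_j)-G^i_kG^k_j$. The flag curvature is $K=R^i_i/F^2$; it satisfies $$R^i_j=K\big(F^2\delta^i_j-F\tfrac{\partial F}{\partial y^j}y^i\big).$$ Suppose that $F$ is a Landsberg metric, that is, $-\tfrac12F\,\frac{\partial^3G^h}{\partial y^i\partial y^j\partial y^k}\frac{\partial F}{\partial y^h}=0$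 for all $i,j,k$, and that $K$ vanishes nowhere on $\mathcal TM$. Fix any chart of $M$ and work in the induced coordinates $(x,y)$ on the part $D$ of $\mathcal TM$ over its domain. Let $m=\frac1{\sqrt{\det g}}\big(-\frac{\partial F}{\partial y^2},\frac{\partial F}{\partial y^1}\big)$ be the positively oriented $g$-unit vector orthogonal to $y$, let $V=Fm^i\frac{\partial}{\partial y^i}$ and $H=Fm^i\frac{\delta}{\delta x^i}$ be the corresponding fields of the Berwald frame, and let $I=F\,C_{ijk}m^im^jm^k$ with $C_{ijk}=\tfrac12\partial g_{ij}/\partial y^k$ be the main scalar. For an open set $U\subseteq D$, call a smooth function $A$ on $U$ an integral of $I$ along $V$ if $A(\gamma(b))-A(\gamma(a))=\int_a^bI(\gamma(t))\,dt$ for every integral curve $\gamma:[a,b]\to U$ of $V$. Then: 1. An integral of $I$ along $V$ exists on $D$. 2. For every open $U\subseteq D$ and every integral $A$ of $I$ along $V$ on $U$ there is a smooth function $K_0$ on $U$ with $V(K_0)=0$ and $K=K_0\exp(-A)$. 3. For all such $U$, $A$ and $K_0$, the function $K_0$ has no zero on $U$, and $\beta:=\frac{S(K_0)}{K_0}-S(A)$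 satisfies on $U$ $$\beta+I\,V(\beta)+H(I)+V(V(\beta))=0.$$ -/

import Mathlib

open scoped Manifold ContDiff

noncomputable section

namespace Finsler

/-- Coordinates `(x, y)` on the tangent bundle of a coordinate domain of an `n`-manifold. -/
abbrev TCoord (n : ℕ) : Type := EuclideanSpace ℝ (Fin n) × EuclideanSpace ℝ (Fin n)

section Coordinates

variable {n : ℕ}

/-- The derivative `X(φ)` of the function `φ` along the vector field `X`. -/
def lieD (X : TCoord n → TCoord n) (φ : TCoord n → ℝ) (p : TCoord n) : ℝ :=
  fderiv ℝ φ p (X p)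

/-- `∂φ/∂xⁱ`. -/
def dX (i : Fin n) (φ : TCoord n → ℝ) : TCoord n → ℝ :=
  lieD (fun _ => (EuclideanSpace.single i 1, 0)) φ

/-- `∂φ/∂yⁱ`. -/
def dY (i : Fin n) (φ : TCoord n → ℝ) : TCoord n → ℝ :=
  lieD (fun _ => (0, EuclideanSpace.single i 1)) φ

/-- The energy `E = F² / 2`. -/
def energy (f : TCoord n → ℝ) (p : TCoord n) : ℝ := f p ^ 2 / 2

/-- The metric tensor `gᵢⱼ = ∂²E/∂yⁱ∂yʲ`. -/
def metric (f : TCoord n → ℝ) (p : TCoord n) : Matrix (Fin n) (Fin n) ℝ :=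
  Matrix.of fun i j => dY i (dY j (energy f)) p

/-- The coefficients `Gⁱ = ½ gⁱʲ (yᵏ ∂²E/∂xᵏ∂yʲ - ∂E/∂xʲ)` of the geodesic spray: the solution of
the Euler-Lagrange equations `S(∂E/∂yʲ) = ∂E/∂xʲ` for `S = yⁱ ∂/∂xⁱ - 2 Gⁱ ∂/∂yⁱ`. -/
def sprayCoeff (f : TCoord n → ℝ) (i : Fin n) (p : TCoord n) : ℝ :=
  1 / 2 * ∑ j, (metric f p)⁻¹ i j *
    ((∑ k, p.2 k * dX k (dY j (energy f)) p) - dX j (energy f) p)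

/-- The geodesic spray `S = yⁱ ∂/∂xⁱ - 2 Gⁱ ∂/∂yⁱ`. -/
def spray (f : TCoord n → ℝ) (p : TCoord n) : TCoord n :=
  (p.2, WithLp.toLp 2 fun i => -2 * sprayCoeff f i p)

/-- The coefficients `Gⁱⱼ = ∂Gⁱ/∂yʲ` of the canonical nonlinear connection. -/
def connCoeff (f : TCoord n → ℝ) (i j : Fin n) : TCoord n → ℝ := dY j (sprayCoeff f i)

/-- The horizontal lift `wⁱ δ/δxⁱ` of `w`, where `δ/δxⁱ = ∂/∂xⁱ - Gʲᵢ ∂/∂yʲ`. -/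
def hlift (f : TCoord n → ℝ) (w : EuclideanSpace ℝ (Fin n)) (p : TCoord n) : TCoord n :=
  (w, WithLp.toLp 2 fun j => -∑ i, connCoeff f j i p * w i)

/-- The components `Rⁱⱼ = 2 ∂Gⁱ/∂xʲ - S(Gⁱⱼ) - Gⁱₖ Gᵏⱼ` of the Jacobi endomorphism. -/
def jacobiEndo (f : TCoord n → ℝ) (i j : Fin n) (p : TCoord n) : ℝ :=
  2 * dX j (sprayCoeff f i) p - lieD (spray f) (connCoeff f i j) p
    - ∑ k, connCoeff f i k p * connCoeff f k j p

/-- The Landsberg tensor `Lᵢⱼₖ = -½ F (∂³Gʰ/∂yⁱ∂yʲ∂yᵏ) ∂F/∂yʰ`. -/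
def landsbergTensor (f : TCoord n → ℝ) (i j k : Fin n) (p : TCoord n) : ℝ :=
  -(1 / 2) * f p * ∑ h, dY i (dY j (dY k (sprayCoeff f h))) p * dY h f p

/-- The flag curvature of a surface: the trace of the Jacobi endomorphism divided by `F²`. -/
def flagCurvature (f : TCoord 2 → ℝ) (p : TCoord 2) : ℝ :=
  (∑ i, jacobiEndo f i i p) / f p ^ 2

/-- The unit vector `m = (-∂F/∂y², ∂F/∂y¹) / √(det g)`, which is `g`-orthogonal to `y` and positively
oriented with respect to the coordinates. -/
def unitNormal (f : TCoord 2 → ℝ) (p : TCoord 2) : EuclideanSpace ℝ (Fin 2) :=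
  (Real.sqrt (metric f p).det)⁻¹ • !₂[-dY 1 f p, dY 0 f p]

/-- The vertical field `V = F mⁱ ∂/∂yⁱ` of the Berwald frame. -/
def frameV (f : TCoord 2 → ℝ) (p : TCoord 2) : TCoord 2 := (0, f p • unitNormal f p)

/-- The horizontal field `H = F mⁱ δ/δxⁱ` of the Berwald frame. -/
def frameH (f : TCoord 2 → ℝ) (p : TCoord 2) : TCoord 2 := hlift f (f p • unitNormal f p) p

/-- The main scalar `I = F Cᵢⱼₖ mⁱ mʲ mᵏ`, with the Cartan tensor `Cᵢⱼₖ = ½ ∂gᵢⱼ/∂yᵏ`. -/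
def mainScalar (f : TCoord 2 → ℝ) (p : TCoord 2) : ℝ :=
  f p * ∑ i, ∑ j, ∑ k, 1 / 2 * dY k (fun q => metric f q i j) p *
    unitNormal f p i * unitNormal f p j * unitNormal f p k

/-- `A` is an integral of `φ` along `X` on `U`: it is smooth on `U`, and
`A (γ b) - A (γ a) = ∫ₐᵇ φ (γ t) dt` for every integral curve `γ` of `X` in `U`. -/
structure IsIntegralAlong (X : TCoord n → TCoord n) (φ A : TCoord n → ℝ) (U : Set (TCoord n)) :
    Prop where
  smooth : ContDiffOn ℝ ∞ A U
  integral_eq : ∀ (a b : ℝ) (γ : ℝ → TCoord n), a ≤ b →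
    (∀ t ∈ Set.Icc a b, γ t ∈ U ∧ HasDerivWithinAt γ (X (γ t)) (Set.Icc a b) t) →
    A (γ b) - A (γ a) = ∫ t in a..b, φ (γ t)

/-- `K₀` is smooth on `U`, `V(K₀) = 0` and `K = K₀ exp(-A)` on `U`. -/
structure IsCurvatureFactor (f A K₀ : TCoord 2 → ℝ) (U : Set (TCoord 2)) : Prop where
  smooth : ContDiffOn ℝ ∞ K₀ U
  lieD_frameV : ∀ p ∈ U, lieD (frameV f) K₀ p = 0
  curvature_eq : ∀ p ∈ U, flagCurvature f p = K₀ p * Real.exp (-A p)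

/-- `β = S(K₀)/K₀ - S(A)`. -/
def beta (f A K₀ : TCoord 2 → ℝ) (p : TCoord 2) : ℝ :=
  lieD (spray f) K₀ p / K₀ p - lieD (spray f) A p

end Coordinates

section Manifold

variable {n : ℕ} {M : Type*} [TopologicalSpace M] [ChartedSpace (EuclideanSpace ℝ (Fin n)) M]

/-- The function `F` on the tangent bundle, written in the coordinates `(x, y)` on the tangent bundle
that are induced by the chart `e` of the manifold. -/
def inChart (F : TangentBundle (𝓡 n) M → ℝ)
    (e : OpenPartialHomeomorph M (EuclideanSpace ℝ (Fin n))) (p : TCoord n) : ℝ :=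
  F ⟨e.symm p.1, mfderiv (𝓡 n) (𝓡 n) e.symm p.1 p.2⟩

/-- The coordinates of the nonzero tangent vectors over the domain of the chart `e`. -/
def slitDomain (e : OpenPartialHomeomorph M (EuclideanSpace ℝ (Fin n))) : Set (TCoord n) :=
  {p | p.1 ∈ e.target ∧ p.2 ≠ 0}

variable [IsManifold (𝓡 n) ∞ M]

/-- `F` is a Finsler function on the manifold `M`. -/
structure IsFinsler (F : TangentBundle (𝓡 n) M → ℝ) : Prop where
  continuous : Continuous F
  smooth : ContMDiffOn (𝓡 n).tangent 𝓘(ℝ, ℝ) ∞ F {v | v.2 ≠ 0}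
  pos : ∀ v : TangentBundle (𝓡 n) M, v.2 ≠ 0 → 0 < F v
  homogeneous : ∀ (x : M) (y : TangentSpace (𝓡 n) x) (c : ℝ), 0 < c →
    F ⟨x, c • y⟩ = c * F ⟨x, y⟩
  nondegenerate : ∀ e ∈ IsManifold.maximalAtlas (𝓡 n) ∞ M, ∀ p ∈ slitDomain e,
    (metric (inChart F e) p).det ≠ 0

/-- The Landsberg tensor vanishes identically. -/
def IsLandsberg (F : TangentBundle (𝓡 n) M → ℝ) : Prop :=
  ∀ e ∈ IsManifold.maximalAtlas (𝓡 n) ∞ M, ∀ p ∈ slitDomain e, ∀ i j k,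
    landsbergTensor (inChart F e) i j k p = 0

end Manifold

/-- The flag curvature of the surface vanishes nowhere on the slit tangent bundle. -/
def HasNonvanishingCurvature {M : Type*} [TopologicalSpace M]
    [ChartedSpace (EuclideanSpace ℝ (Fin 2)) M] [IsManifold (𝓡 2) ∞ M]
    (F : TangentBundle (𝓡 2) M → ℝ) : Prop :=
  ∀ e ∈ IsManifold.maximalAtlas (𝓡 2) ∞ M, ∀ p ∈ slitDomain e,
    flagCurvature (inChart F e) p ≠ 0

end Finsler

end

/-! The Berwald frame `S`, `H`, `V` of a Landsberg surface satisfies [V,S] = H, [S,H] = K F² V and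
[V,H] = -S - I H. Only the last relation uses the Landsberg condition. The Jacobi identity of the
three fields reads S(I) H + F² (V(K) + I K) V = 0 (`jacobi_frame`), hence S(I) = 0 and V(K) = -I K
(`S_I`, `V_K`).

Since I is the logarithmic derivative of √det g along V, A = log √det g is a global integral. For
any integral A, V(A) = I, so K exp(A) is annihilated by V; this is K₀. Moreover β = S(K)/K, whatever
A and K₀ are. Applying V to log |K| and commuting gives V(β) = H(K)/K, then V(V(β)) = -H(I) - β - I
V(β), the claim (`beta_identity`).

The identities are proved in a commutative algebra with derivations, where they are polynomial, and
then read in the algebra of smooth functions on the slit domain. The square root of det g needs det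
g > 0. On each fibre g is positive definite where F is minimal on the unit circle, and det g cannot
change sign on the connected punctured plane (`det_metric_pos`). -/

namespace Finsler

/-! ### Algebraic model of a Finsler surface. -/

/-- A commutative algebra with the operations of the smooth functions on the slit tangent bundle of
a coordinate domain of a surface: the coordinate derivations, the coordinates, a Finsler function
`F` with energy `E`, the square root `s` of the determinant of its metric tensor, and its spray
coefficients `G`. -/
structure FinslerAlgebra (𝒜 : Type*) [CommRing 𝒜] [Algebra ℝ 𝒜] where
  X : Fin 2 → Derivation ℝ 𝒜 𝒜
  Y : Fin 2 → Derivation ℝ 𝒜 𝒜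
  X_X : ∀ i j a, X i (X j a) = X j (X i a)
  Y_X : ∀ i j a, Y i (X j a) = X j (Y i a)
  Y_Y : ∀ i j a, Y i (Y j a) = Y j (Y i a)
  x : Fin 2 → 𝒜
  y : Fin 2 → 𝒜
  X_x : ∀ i j, X i (x j) = if i = j then 1 else 0
  Y_x : ∀ i j, Y i (x j) = 0
  X_y : ∀ i j, X i (y j) = 0
  Y_y : ∀ i j, Y i (y j) = if i = j then 1 else 0
  F : 𝒜
  F' : 𝒜
  F_mul_inv : F * F' = 1
  euler : y 0 * Y 0 F + y 1 * Y 1 F = F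
  E : 𝒜
  two_mul_E : 2 * E = F * F
  s : 𝒜
  s' : 𝒜
  s_mul_inv : s * s' = 1
  s_mul_self : s * s = Y 0 (Y 0 E) * Y 1 (Y 1 E) - Y 0 (Y 1 E) * Y 0 (Y 1 E)
  G : Fin 2 → 𝒜
  two_mul_G : ∀ j, 2 * (Y 0 (Y j E) * G 0 + Y 1 (Y j E) * G 1) =
    y 0 * X 0 (Y j E) + y 1 * X 1 (Y j E) - X j E

namespace FinslerAlgebra

variable {𝒜 : Type*} [CommRing 𝒜] [Algebra ℝ 𝒜]

lemma two_cancel {a b : 𝒜} (h : 2 * a = 2 * b) : a = b := by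
  have h2 : algebraMap ℝ 𝒜 (1 / 2) * 2 = 1 := by
    rw [← map_ofNat (algebraMap ℝ 𝒜) 2, ← map_mul]; norm_num
  linear_combination algebraMap ℝ 𝒜 (1 / 2) * h - (a - b) * h2

@[simp] lemma derivation_two (D : Derivation ℝ 𝒜 𝒜) : D 2 = 0 := by
  simpa using D.map_natCast 2

lemma derivation_mul (D : Derivation ℝ 𝒜 𝒜) (a b : 𝒜) : D (a * b) = a * D b + b * D a := by
  simp

variable (Φ : FinslerAlgebra 𝒜)

@[simp] lemma X_one_X_zero (a : 𝒜) : Φ.X 1 (Φ.X 0 a) = Φ.X 0 (Φ.X 1 a) := Φ.X_X _ _ _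
@[simp] lemma Y_X' (i j : Fin 2) (a : 𝒜) : Φ.Y i (Φ.X j a) = Φ.X j (Φ.Y i a) := Φ.Y_X _ _ _
@[simp] lemma Y_one_Y_zero (a : 𝒜) : Φ.Y 1 (Φ.Y 0 a) = Φ.Y 0 (Φ.Y 1 a) := Φ.Y_Y _ _ _

/-- The spray. -/
noncomputable def S : Derivation ℝ 𝒜 𝒜 :=
  Φ.y 0 • Φ.X 0 + Φ.y 1 • Φ.X 1 - (2 * Φ.G 0) • Φ.Y 0 - (2 * Φ.G 1) • Φ.Y 1

/-- The nonlinear connection. -/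
noncomputable def N (i j : Fin 2) : 𝒜 := Φ.Y j (Φ.G i)

/-- The horizontal derivations `δ/δxʲ`. -/
noncomputable def δ (j : Fin 2) : Derivation ℝ 𝒜 𝒜 :=
  Φ.X j - Φ.N 0 j • Φ.Y 0 - Φ.N 1 j • Φ.Y 1

/-- The Jacobi endomorphism. -/
noncomputable def R (i j : Fin 2) : 𝒜 :=
  2 * Φ.X j (Φ.G i) - Φ.S (Φ.N i j) - (Φ.N i 0 * Φ.N 0 j + Φ.N i 1 * Φ.N 1 j)

/-- The components of the Berwald frame. -/
noncomputable def u : Fin 2 → 𝒜 := ![-(Φ.s' * Φ.Y 1 Φ.E), Φ.s' * Φ.Y 0 Φ.E]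

/-- The vertical derivation of the Berwald frame. -/
noncomputable def V : Derivation ℝ 𝒜 𝒜 := Φ.u 0 • Φ.Y 0 + Φ.u 1 • Φ.Y 1

/-- The horizontal derivation of the Berwald frame. -/
noncomputable def H : Derivation ℝ 𝒜 𝒜 := Φ.u 0 • Φ.δ 0 + Φ.u 1 • Φ.δ 1

/-- The main scalar. -/
noncomputable def I : 𝒜 := Φ.s' * Φ.V Φ.s

/-- The flag curvature. -/
noncomputable def K : 𝒜 := (Φ.R 0 0 + Φ.R 1 1) * (Φ.F' * Φ.F')

/-- The vanishing of the Landsberg tensor. -/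
def Landsberg : Prop := ∀ i j k, Φ.Y i (Φ.Y j (Φ.Y k (Φ.G 0))) * Φ.Y 0 Φ.E +
  Φ.Y i (Φ.Y j (Φ.Y k (Φ.G 1))) * Φ.Y 1 Φ.E = 0

lemma S_apply (a : 𝒜) : Φ.S a =
    Φ.y 0 * Φ.X 0 a + Φ.y 1 * Φ.X 1 a - 2 * Φ.G 0 * Φ.Y 0 a - 2 * Φ.G 1 * Φ.Y 1 a := by
  simp [S]

lemma δ_apply (j : Fin 2) (a : 𝒜) :
    Φ.δ j a = Φ.X j a - Φ.N 0 j * Φ.Y 0 a - Φ.N 1 j * Φ.Y 1 a := by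
  simp [δ]

lemma V_apply (a : 𝒜) : Φ.V a = Φ.u 0 * Φ.Y 0 a + Φ.u 1 * Φ.Y 1 a := by simp [V]

lemma H_apply (a : 𝒜) : Φ.H a = Φ.u 0 * Φ.δ 0 a + Φ.u 1 * Φ.δ 1 a := by simp [H]

/-! ### Homogeneity relations for the energy. -/

lemma Y_E (i : Fin 2) : Φ.Y i Φ.E = Φ.F * Φ.Y i Φ.F := by
  have h := congrArg (Φ.Y i) Φ.two_mul_E
  simp only [derivation_two, derivation_mul] at h
  exact two_cancel (by linear_combination h)

lemma F_cancel {a : 𝒜} (h : Φ.F * a = 0) : a = 0 := by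
  linear_combination Φ.F' * h - a * Φ.F_mul_inv

lemma s_cancel {a : 𝒜} (h : Φ.s * a = 0) : a = 0 := by
  linear_combination Φ.s' * h - a * Φ.s_mul_inv

lemma euler_E : Φ.y 0 * Φ.Y 0 Φ.E + Φ.y 1 * Φ.Y 1 Φ.E = 2 * Φ.E := by
  rw [Y_E, Y_E]
  linear_combination Φ.F * Φ.euler - Φ.two_mul_E

lemma euler_Y_E (j : Fin 2) :
    Φ.y 0 * Φ.Y 0 (Φ.Y j Φ.E) + Φ.y 1 * Φ.Y 1 (Φ.Y j Φ.E) = Φ.Y j Φ.E := by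
  have h := congrArg (Φ.Y j) Φ.euler_E
  fin_cases j <;> simp [Φ.Y_y] at h ⊢ <;> linear_combination h

lemma euler_Y_Y_E (i j : Fin 2) :
    Φ.y 0 * Φ.Y 0 (Φ.Y i (Φ.Y j Φ.E)) + Φ.y 1 * Φ.Y 1 (Φ.Y i (Φ.Y j Φ.E)) = 0 := by
  have h := congrArg (Φ.Y i) (Φ.euler_Y_E j)
  fin_cases i <;> fin_cases j <;> simp [Φ.Y_y] at h ⊢ <;> linear_combination h

lemma X_euler_E (i : Fin 2) : Φ.y 0 * Φ.X i (Φ.Y 0 Φ.E) + Φ.y 1 * Φ.X i (Φ.Y 1 Φ.E) =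
    2 * Φ.X i Φ.E := by
  have h := congrArg (Φ.X i) Φ.euler_E
  simpa [Φ.X_y] using h

lemma X_euler_Y_E (i j : Fin 2) :
    Φ.y 0 * Φ.X i (Φ.Y 0 (Φ.Y j Φ.E)) + Φ.y 1 * Φ.X i (Φ.Y 1 (Φ.Y j Φ.E)) = Φ.X i (Φ.Y j Φ.E) := by
  have h := congrArg (Φ.X i) (Φ.euler_Y_E j)
  simpa [Φ.X_y] using h

/-- The metric tensor is nondegenerate. -/
lemma metric_cancel {a b : 𝒜} (h₀ : Φ.Y 0 (Φ.Y 0 Φ.E) * a + Φ.Y 0 (Φ.Y 1 Φ.E) * b = 0)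
    (h₁ : Φ.Y 0 (Φ.Y 1 Φ.E) * a + Φ.Y 1 (Φ.Y 1 Φ.E) * b = 0) : a = 0 ∧ b = 0 := by
  constructor <;> apply Φ.s_cancel <;> apply Φ.s_cancel
  · linear_combination a * Φ.s_mul_self + Φ.Y 1 (Φ.Y 1 Φ.E) * h₀ - Φ.Y 0 (Φ.Y 1 Φ.E) * h₁
  · linear_combination b * Φ.s_mul_self + Φ.Y 0 (Φ.Y 0 Φ.E) * h₁ - Φ.Y 0 (Φ.Y 1 Φ.E) * h₀

/-! ### The spray, the horizontal derivations and the Jacobi endomorphism. -/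

lemma euler_lagrange (j : Fin 2) : Φ.S (Φ.Y j Φ.E) = Φ.X j Φ.E := by
  rw [S_apply]
  linear_combination -Φ.two_mul_G j

lemma S_y (j : Fin 2) : Φ.S (Φ.y j) = -2 * Φ.G j := by
  rw [S_apply]
  fin_cases j <;> simp [Φ.Y_y, Φ.X_y]

/-- Apply S to Euler's relation yʲ ∂E/∂yʲ = 2E. By the Euler-Lagrange equations the left side
becomes S(E), the right side is 2 S(E). -/
lemma S_E : Φ.S Φ.E = 0 := by
  have h := congrArg Φ.S Φ.euler_E
  simp only [derivation_two, derivation_mul, map_add, euler_lagrange, S_y] at h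
  rw [S_apply] at h ⊢
  linear_combination -h

/-- The nonlinear connection arises from this bracket of the spray with a vertical coordinate field.
-/
lemma Y_S (j : Fin 2) (a : 𝒜) : Φ.Y j (Φ.S a) =
    Φ.S (Φ.Y j a) + Φ.δ j a - Φ.N 0 j * Φ.Y 0 a - Φ.N 1 j * Φ.Y 1 a := by
  simp only [S_apply, δ_apply, N]
  fin_cases j <;> simp [Φ.Y_y] <;> ring

/-- Evaluated on E, the bracket `Y_S` is 2 δE/δxʲ, while S(E) = 0. -/
lemma δ_E (j : Fin 2) : Φ.δ j Φ.E = 0 := by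
  have h := Φ.Y_S j Φ.E
  rw [S_E, map_zero, euler_lagrange] at h
  have h' := Φ.δ_apply j Φ.E
  exact two_cancel (by linear_combination h' - h)

lemma δ_F (j : Fin 2) : Φ.δ j Φ.F = 0 := by
  have h := congrArg (Φ.δ j) Φ.two_mul_E
  simp only [derivation_two, derivation_mul, δ_E] at h
  exact Φ.F_cancel (two_cancel (by linear_combination -h))

lemma X_E (j : Fin 2) : Φ.X j Φ.E = Φ.N 0 j * Φ.Y 0 Φ.E + Φ.N 1 j * Φ.Y 1 Φ.E := by
  have h := Φ.δ_apply j Φ.E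
  rw [δ_E] at h
  linear_combination -h

/-- Homogeneity of G is a consequence of that of F: in the linear system defining G the matrix has
degree 0 and the right side degree 2, and nondegeneracy cancels the matrix. -/
lemma euler_G (i : Fin 2) : Φ.y 0 * Φ.N i 0 + Φ.y 1 * Φ.N i 1 = 2 * Φ.G i := by
  have key : ∀ j, Φ.Y 0 (Φ.Y j Φ.E) * (Φ.y 0 * Φ.N 0 0 + Φ.y 1 * Φ.N 0 1 - 2 * Φ.G 0) +
      Φ.Y 1 (Φ.Y j Φ.E) * (Φ.y 0 * Φ.N 1 0 + Φ.y 1 * Φ.N 1 1 - 2 * Φ.G 1) = 0 := by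
    intro j
    apply two_cancel
    have h0 := congrArg (Φ.Y 0) (Φ.two_mul_G j)
    have h1 := congrArg (Φ.Y 1) (Φ.two_mul_G j)
    have e0 := Φ.euler_Y_Y_E 0 j
    have e1 := Φ.euler_Y_Y_E 1 j
    have a := Φ.two_mul_G j
    have b0 := Φ.X_euler_Y_E 0 j
    have b1 := Φ.X_euler_Y_E 1 j
    have c := Φ.X_euler_E j
    fin_cases j <;> simp [Φ.Y_y, N] at h0 h1 e0 e1 a b0 b1 c ⊢ <;>
    linear_combination Φ.y 0 * h0 + Φ.y 1 * h1 - 2 * a - 2 * Φ.G 0 * e0 - 2 * Φ.G 1 * e1 +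
      Φ.y 0 * b0 + Φ.y 1 * b1 - c
  have h := Φ.metric_cancel (by simpa using key 0) (by simpa using key 1)
  fin_cases i <;> simp only [Fin.zero_eta, Fin.mk_one]
  · linear_combination h.1
  · linear_combination h.2

lemma S_eq (a : 𝒜) : Φ.S a = Φ.y 0 * Φ.δ 0 a + Φ.y 1 * Φ.δ 1 a := by
  rw [S_apply, δ_apply, δ_apply]
  linear_combination Φ.Y 0 a * Φ.euler_G 0 + Φ.Y 1 a * Φ.euler_G 1

lemma S_F : Φ.S Φ.F = 0 := by simp [S_eq, δ_F]

/-- Up to sign conventions, R is the obstruction to S preserving the horizontal distribution: it is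
the vertical part of this bracket. -/
lemma S_δ (j : Fin 2) (a : 𝒜) : Φ.S (Φ.δ j a) = Φ.δ j (Φ.S a) + Φ.N 0 j * Φ.δ 0 a +
    Φ.N 1 j * Φ.δ 1 a + Φ.R 0 j * Φ.Y 0 a + Φ.R 1 j * Φ.Y 1 a := by
  simp only [S_apply, δ_apply, R, N]
  fin_cases j <;> simp [Φ.Y_y, Φ.X_y] <;> ring

/-- S and every δ/δxᵏ annihilate F, so the vertical part of their bracket does too. -/
lemma R_mul_Y_F (j : Fin 2) : Φ.R 0 j * Φ.Y 0 Φ.F + Φ.R 1 j * Φ.Y 1 Φ.F = 0 := by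
  have h := Φ.S_δ j Φ.F
  simp only [δ_F, S_F, map_zero] at h
  linear_combination -h

lemma R_mul_y (i : Fin 2) : Φ.R i 0 * Φ.y 0 + Φ.R i 1 * Φ.y 1 = 0 := by
  have h := congrArg Φ.S (Φ.euler_G i)
  simp only [derivation_two, derivation_mul, map_add, S_y] at h
  have h' := Φ.S_apply (Φ.G i)
  have h0 := Φ.euler_G 0
  have h1 := Φ.euler_G 1
  simp only [N, R] at *
  linear_combination -h - 2 * h' - Φ.Y 0 (Φ.G i) * h0 - Φ.Y 1 (Φ.G i) * h1

lemma R_trace : Φ.R 0 0 + Φ.R 1 1 = Φ.K * (Φ.F * Φ.F) := by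
  rw [K]
  linear_combination -(Φ.R 0 0 + Φ.R 1 1) * (1 + Φ.F * Φ.F') * Φ.F_mul_inv

/-- In dimension two an endomorphism that kills y and has image in the kernel of the vertical
differential of F is determined by its trace. -/
lemma R_eq (i j : Fin 2) : Φ.R i j =
    Φ.K * (Φ.F * Φ.F * (if i = j then 1 else 0) - Φ.F * Φ.Y j Φ.F * Φ.y i) := by
  have h0 := Φ.R_mul_Y_F 0
  have h1 := Φ.R_mul_Y_F 1
  have k0 := Φ.R_mul_y 0
  have k1 := Φ.R_mul_y 1
  have e := Φ.euler
  have t := Φ.R_trace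
  refine sub_eq_zero.mp (Φ.F_cancel ?_)
  fin_cases i <;> fin_cases j <;> simp
  · linear_combination Φ.Y 0 Φ.F * k0 - Φ.y 1 * h1 + Φ.R 1 1 * e + (Φ.F - Φ.Y 0 Φ.F * Φ.y 0) * t
  · linear_combination Φ.y 0 * h1 + Φ.Y 1 Φ.F * k0 - Φ.R 0 1 * e - Φ.Y 1 Φ.F * Φ.y 0 * t
  · linear_combination Φ.y 1 * h0 + Φ.Y 0 Φ.F * k1 - Φ.R 1 0 * e - Φ.Y 0 Φ.F * Φ.y 1 * t
  · linear_combination Φ.Y 1 Φ.F * k1 - Φ.y 0 * h0 + Φ.R 0 0 * e + (Φ.F - Φ.Y 1 Φ.F * Φ.y 1) * t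

/-! ### Derivatives of the metric and of the Berwald frame. -/

/-- The second vertical derivatives of G cancel because they are symmetric in i and j; only
first-order terms in N survive. -/
lemma S_Y_Y_E (i j : Fin 2) : Φ.S (Φ.Y i (Φ.Y j Φ.E)) =
    Φ.N 0 i * Φ.Y 0 (Φ.Y j Φ.E) + Φ.N 1 i * Φ.Y 1 (Φ.Y j Φ.E) +
    Φ.N 0 j * Φ.Y 0 (Φ.Y i Φ.E) + Φ.N 1 j * Φ.Y 1 (Φ.Y i Φ.E) := by
  have h := Φ.Y_S i (Φ.Y j Φ.E)
  rw [euler_lagrange, δ_apply] at h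
  have a := congrArg (Φ.Y i) (Φ.X_E j)
  have b := congrArg (Φ.Y j) (Φ.X_E i)
  fin_cases i <;> fin_cases j <;> simp [N] at h a b ⊢ <;> linear_combination -h - b + 2 * a - a

/-- A derivation that acts on the metric through the matrix `P` multiplies the area element by the
trace of `P`. -/
lemma derivation_s {D : Derivation ℝ 𝒜 𝒜} {P : Fin 2 → Fin 2 → 𝒜}
    (h : ∀ i j, D (Φ.Y i (Φ.Y j Φ.E)) = P 0 i * Φ.Y 0 (Φ.Y j Φ.E) + P 1 i * Φ.Y 1 (Φ.Y j Φ.E) +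
      P 0 j * Φ.Y 0 (Φ.Y i Φ.E) + P 1 j * Φ.Y 1 (Φ.Y i Φ.E)) :
    D Φ.s = (P 0 0 + P 1 1) * Φ.s := by
  have h' := congrArg D Φ.s_mul_self
  simp only [derivation_mul, map_sub, h, Y_one_Y_zero] at h'
  refine sub_eq_zero.mp (Φ.s_cancel (two_cancel ?_))
  linear_combination h' - 2 * (P 0 0 + P 1 1) * Φ.s_mul_self

lemma derivation_s' {D : Derivation ℝ 𝒜 𝒜} {t : 𝒜} (h : D Φ.s = t * Φ.s) :
    D Φ.s' = -(t * Φ.s') := by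
  have h' := congrArg D Φ.s_mul_inv
  simp only [derivation_mul, h, Derivation.map_one_eq_zero] at h'
  linear_combination Φ.s' * h' - (D Φ.s' + t * Φ.s') * Φ.s_mul_inv

/-- The vector u is the rotated covector dE divided by the area element, so a linear action of D on
covariant tensors through P induces the dual action on u. It is used for S with P = N and for H with
P = V(N). -/
lemma derivation_u {D : Derivation ℝ 𝒜 𝒜} {P : Fin 2 → Fin 2 → 𝒜}
    (h : ∀ i j, D (Φ.Y i (Φ.Y j Φ.E)) = P 0 i * Φ.Y 0 (Φ.Y j Φ.E) + P 1 i * Φ.Y 1 (Φ.Y j Φ.E) +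
      P 0 j * Φ.Y 0 (Φ.Y i Φ.E) + P 1 j * Φ.Y 1 (Φ.Y i Φ.E))
    (h' : ∀ j, D (Φ.Y j Φ.E) = P 0 j * Φ.Y 0 Φ.E + P 1 j * Φ.Y 1 Φ.E) (k : Fin 2) :
    D (Φ.u k) = -(P k 0 * Φ.u 0 + P k 1 * Φ.u 1) := by
  have hs := Φ.derivation_s' (Φ.derivation_s h)
  fin_cases k <;> simp [u, h', hs] <;> ring

lemma S_u (k : Fin 2) : Φ.S (Φ.u k) = -(Φ.N k 0 * Φ.u 0 + Φ.N k 1 * Φ.u 1) :=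
  Φ.derivation_u Φ.S_Y_Y_E (fun j => (Φ.euler_lagrange j).trans (Φ.X_E j)) k

lemma Y_N (i j k : Fin 2) : Φ.Y i (Φ.N k j) = Φ.Y j (Φ.N k i) := Φ.Y_Y _ _ _

lemma Y_δ (i j : Fin 2) (a : 𝒜) : Φ.Y i (Φ.δ j a) =
    Φ.δ j (Φ.Y i a) - Φ.Y i (Φ.N 0 j) * Φ.Y 0 a - Φ.Y i (Φ.N 1 j) * Φ.Y 1 a := by
  simp only [δ_apply]
  fin_cases i <;> fin_cases j <;> simp <;> ring

lemma δ_Y_E (i j : Fin 2) : Φ.δ i (Φ.Y j Φ.E) =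
    Φ.Y i (Φ.N 0 j) * Φ.Y 0 Φ.E + Φ.Y i (Φ.N 1 j) * Φ.Y 1 Φ.E := by
  have h := Φ.Y_δ j i Φ.E
  rw [δ_E, map_zero, Y_N, Φ.Y_N j] at h
  linear_combination -h

/-- The Landsberg condition enters here. Differentiating `δ_Y_E` vertically produces one term with
third derivatives of G contracted with dE, and that term is the Landsberg tensor up to a factor. -/
lemma δ_Y_Y_E (hL : Φ.Landsberg) (k i j : Fin 2) : Φ.δ k (Φ.Y i (Φ.Y j Φ.E)) =
    Φ.Y k (Φ.N 0 i) * Φ.Y 0 (Φ.Y j Φ.E) + Φ.Y k (Φ.N 1 i) * Φ.Y 1 (Φ.Y j Φ.E) +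
    Φ.Y k (Φ.N 0 j) * Φ.Y 0 (Φ.Y i Φ.E) + Φ.Y k (Φ.N 1 j) * Φ.Y 1 (Φ.Y i Φ.E) := by
  have h := Φ.Y_δ i k (Φ.Y j Φ.E)
  rw [δ_Y_E, Φ.Y_N i, Φ.Y_N i] at h
  simp only [map_add, derivation_mul] at h
  have hl := hL i k j
  rw [Φ.Y_Y 0 i, Φ.Y_Y 1 i]
  simp only [N] at *
  linear_combination hl - h

lemma H_u (hL : Φ.Landsberg) (k : Fin 2) :
    Φ.H (Φ.u k) = -(Φ.V (Φ.N k 0) * Φ.u 0 + Φ.V (Φ.N k 1) * Φ.u 1) := by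
  apply Φ.derivation_u (P := fun i j => Φ.V (Φ.N i j))
  · intro i j
    simp only [H_apply, V_apply, Φ.δ_Y_Y_E hL]
    ring
  · intro j
    simp only [H_apply, V_apply, Φ.δ_Y_E]
    ring

lemma V_s : Φ.V Φ.s = Φ.I * Φ.s := by
  rw [I]
  linear_combination -Φ.V Φ.s * Φ.s_mul_inv

/-- Differentiating `s'` gives the term with I. The derivative of dE gives -y, since dE = g y and
the square of `s'` cancels det g. -/
lemma V_u (k : Fin 2) : Φ.V (Φ.u k) = -Φ.y k - Φ.I * Φ.u k := by
  have hs := Φ.derivation_s' Φ.V_s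
  have h0 := Φ.euler_Y_E 0
  have h1 := Φ.euler_Y_E 1
  have hd := Φ.s_mul_self
  have hi := Φ.s_mul_inv
  rw [V_apply] at hs
  rw [V_apply]
  fin_cases k <;> simp [u] at hs h0 h1 ⊢
  · linear_combination -Φ.Y 1 Φ.E * hs + Φ.s' ^ 2 *
      (Φ.Y 1 (Φ.Y 1 Φ.E) * h0 - Φ.Y 0 (Φ.Y 1 Φ.E) * h1 + Φ.y 0 * hd) - Φ.y 0 * (1 + Φ.s * Φ.s') * hi
  · linear_combination Φ.Y 0 Φ.E * hs + Φ.s' ^ 2 *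
      (Φ.Y 0 (Φ.Y 0 Φ.E) * h1 - Φ.Y 0 (Φ.Y 1 Φ.E) * h0 + Φ.y 1 * hd) - Φ.y 1 * (1 + Φ.s * Φ.s') * hi

lemma V_E : Φ.V Φ.E = 0 := by
  simp [V_apply, u]; ring

lemma V_F : Φ.V Φ.F = 0 := by
  have h := congrArg Φ.V Φ.two_mul_E
  simp only [derivation_two, derivation_mul, V_E] at h
  exact Φ.F_cancel (two_cancel (by linear_combination -h))

/-! ### Commutation relations of the Berwald frame and their Jacobi identity. -/

lemma V_S (a : 𝒜) : Φ.V (Φ.S a) = Φ.S (Φ.V a) + Φ.H a := by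
  have h0 := Φ.S_u 0
  have h1 := Φ.S_u 1
  simp only [V_apply, H_apply, Y_S, map_add, derivation_mul]
  linear_combination -Φ.Y 0 a * h0 - Φ.Y 1 a * h1

lemma R_mul_u (i : Fin 2) :
    Φ.R i 0 * Φ.u 0 + Φ.R i 1 * Φ.u 1 = Φ.K * (Φ.F * Φ.F) * Φ.u i := by
  fin_cases i <;> simp [R_eq, u, Y_E] <;> ring

lemma S_H (a : 𝒜) : Φ.S (Φ.H a) = Φ.H (Φ.S a) + Φ.K * (Φ.F * Φ.F) * Φ.V a := by
  have h0 := Φ.S_u 0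
  have h1 := Φ.S_u 1
  have r0 := Φ.R_mul_u 0
  have r1 := Φ.R_mul_u 1
  simp only [V_apply, H_apply, S_δ, map_add, derivation_mul]
  linear_combination Φ.δ 0 a * h0 + Φ.δ 1 a * h1 + Φ.Y 0 a * r0 + Φ.Y 1 a * r1

lemma V_H (hL : Φ.Landsberg) (a : 𝒜) :
    Φ.V (Φ.H a) = Φ.H (Φ.V a) - Φ.S a - Φ.I * Φ.H a := by
  have h0 := Φ.H_u hL 0
  have h1 := Φ.H_u hL 1
  have v0 := Φ.V_u 0
  have v1 := Φ.V_u 1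
  rw [S_eq]
  simp only [V_apply, H_apply, Y_δ, map_add, derivation_mul] at *
  linear_combination Φ.δ 0 a * v0 + Φ.δ 1 a * v1 - Φ.Y 0 a * h0 - Φ.Y 1 a * h1

/-- The Jacobi identity for the Berwald frame of a Landsberg surface. -/
lemma jacobi_frame (hL : Φ.Landsberg) (a : 𝒜) :
    Φ.S Φ.I * Φ.H a + Φ.F * Φ.F * (Φ.V Φ.K + Φ.I * Φ.K) * Φ.V a = 0 := by
  have h1 := congrArg Φ.S (Φ.V_H hL a)
  have h2 := congrArg Φ.V (Φ.S_H a)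
  have h3 := Φ.V_S (Φ.H a)
  have h4 := Φ.S_H (Φ.V a)
  have h5 := congrArg Φ.H (Φ.V_S a)
  have h6 := Φ.V_H hL (Φ.S a)
  have h7 := Φ.S_H a
  simp only [map_add, map_sub, derivation_mul, V_F] at *
  -- The double bracket [H,[S,V]] vanishes because [V,S] = H. Up to a common sign, [S,[V,H]] gives
  -- S(I) H + I K F² V and [V,[H,S]] gives F² V(K) V, as V(F) = 0.
  linear_combination h3 + h1 + h4 - h2 - h6 - h5 - Φ.I * h7

/-- The combination s (y⁰ u¹ - y¹ u⁰) equals F², which is invertible. -/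
lemma u_generate {a : 𝒜} (h0 : a * Φ.u 0 = 0) (h1 : a * Φ.u 1 = 0) : a = 0 := by
  have e := Φ.euler
  have hi := Φ.s_mul_inv
  simp only [u, Matrix.cons_val_zero, Matrix.cons_val_one, Y_E] at h0 h1
  apply Φ.F_cancel
  apply Φ.F_cancel
  linear_combination -Φ.F * a * e + Φ.s * Φ.y 0 * h1 - Φ.s * Φ.y 1 * h0 -
    Φ.F * a * (Φ.y 0 * Φ.Y 0 Φ.F + Φ.y 1 * Φ.Y 1 Φ.F) * hi

/-- The functions xⁱ isolate the H-component of the Jacobi identity: V(xⁱ) = 0 and H(xⁱ) = uⁱ. -/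
lemma S_I (hL : Φ.Landsberg) : Φ.S Φ.I = 0 := by
  have key : ∀ i, Φ.S Φ.I * Φ.u i = 0 := by
    intro i
    have h := Φ.jacobi_frame hL (Φ.x i)
    simp only [H_apply, V_apply, δ_apply, Φ.X_x, Φ.Y_x] at h
    fin_cases i <;> simpa using h
  exact Φ.u_generate (key 0) (key 1)

/-- With S(I) = 0 the H-component is gone, and V(yⁱ) = uⁱ isolates the rest. -/
lemma V_K (hL : Φ.Landsberg) : Φ.V Φ.K = -(Φ.I * Φ.K) := by
  have key : ∀ i, (Φ.F * (Φ.F * (Φ.V Φ.K + Φ.I * Φ.K))) * Φ.u i = 0 := by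
    intro i
    have h := Φ.jacobi_frame hL (Φ.y i)
    rw [Φ.S_I hL] at h
    simp only [V_apply, Φ.Y_y] at h ⊢
    fin_cases i <;> simp at h ⊢ <;> linear_combination h
  linear_combination Φ.F_cancel (Φ.F_cancel (Φ.u_generate (key 0) (key 1)))

/-- The identity satisfied by the logarithmic derivative of the curvature along the spray. -/
lemma beta_identity (hL : Φ.Landsberg) {K' β : 𝒜} (hK : Φ.K * K' = 1) (hβ : β * Φ.K = Φ.S Φ.K) :
    β + Φ.I * Φ.V β + Φ.H Φ.I + Φ.V (Φ.V β) = 0 := by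
  have hV := Φ.V_K hL
  have e0 := congrArg Φ.V hβ
  rw [Φ.V_S, hV] at e0
  -- The term S(I) K drops out, and the two terms I S(K) = I β K cancel.
  have e1 : Φ.V β * Φ.K = Φ.H Φ.K := by
    simp only [map_neg, derivation_mul, Φ.S_I hL, hV] at e0
    linear_combination e0 + Φ.I * hβ
  have e2 := congrArg Φ.V e1
  rw [Φ.V_H hL, hV] at e2
  simp only [map_neg, derivation_mul, hV] at e2
  have e3 : Φ.K * (β + Φ.I * Φ.V β + Φ.H Φ.I + Φ.V (Φ.V β)) = 0 := by
    linear_combination e2 + hβ + 2 * Φ.I * e1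
  linear_combination K' * e3 - (β + Φ.I * Φ.V β + Φ.H Φ.I + Φ.V (Φ.V β)) * hK

/-- The main scalar in terms of the Cartan tensor. -/
lemma two_mul_F_mul_F_mul_I : 2 * (Φ.F * Φ.F) * Φ.I =
    ∑ i, ∑ j, ∑ k, Φ.Y k (Φ.Y i (Φ.Y j Φ.E)) * Φ.u i * Φ.u j * Φ.u k := by
  have hd := congrArg Φ.V Φ.s_mul_self
  rw [derivation_mul, V_s] at hd
  simp only [derivation_mul, map_sub] at hd
  have hs := Φ.s_mul_self
  have hi := Φ.s_mul_inv
  have h0 := Φ.euler_Y_E 0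
  have h1 := Φ.euler_Y_E 1
  have hF : Φ.F * Φ.F = Φ.y 0 * Φ.Y 0 Φ.E + Φ.y 1 * Φ.Y 1 Φ.E := by
    rw [Φ.euler_E, Φ.two_mul_E]
  have c00 := Φ.euler_Y_Y_E 0 0
  have c01 := Φ.euler_Y_Y_E 0 1
  have c11 := Φ.euler_Y_Y_E 1 1
  -- The metric has degree 0 in y, so its derivative along V annihilates y.
  have v0 : Φ.y 0 * Φ.V (Φ.Y 0 (Φ.Y 0 Φ.E)) + Φ.y 1 * Φ.V (Φ.Y 0 (Φ.Y 1 Φ.E)) = 0 := by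
    simp only [V_apply, Y_one_Y_zero] at *
    linear_combination Φ.u 0 * c00 + Φ.u 1 * c01
  have v1 : Φ.y 0 * Φ.V (Φ.Y 0 (Φ.Y 1 Φ.E)) + Φ.y 1 * Φ.V (Φ.Y 1 (Φ.Y 1 Φ.E)) = 0 := by
    simp only [V_apply, Y_one_Y_zero] at *
    linear_combination Φ.u 0 * c01 + Φ.u 1 * c11
  have e : ∑ i, ∑ j, ∑ k, Φ.Y k (Φ.Y i (Φ.Y j Φ.E)) * Φ.u i * Φ.u j * Φ.u k =
      Φ.V (Φ.Y 0 (Φ.Y 0 Φ.E)) * Φ.u 0 ^ 2 + 2 * Φ.V (Φ.Y 0 (Φ.Y 1 Φ.E)) * (Φ.u 0 * Φ.u 1) +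
        Φ.V (Φ.Y 1 (Φ.Y 1 Φ.E)) * Φ.u 1 ^ 2 := by
    simp only [Fin.sum_univ_two, V_apply, Y_one_Y_zero]
    ring
  rw [e]
  simp only [u, Matrix.cons_val_zero, Matrix.cons_val_one]
  simp only [Y_one_Y_zero] at h0
  generalize Φ.V (Φ.Y 0 (Φ.Y 0 Φ.E)) = V00 at *
  generalize Φ.V (Φ.Y 0 (Φ.Y 1 Φ.E)) = V01 at *
  generalize Φ.V (Φ.Y 1 (Φ.Y 1 Φ.E)) = V11 at *
  generalize Φ.Y 0 (Φ.Y 0 Φ.E) = g00 at *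
  generalize Φ.Y 0 (Φ.Y 1 Φ.E) = g01 at *
  generalize Φ.Y 1 (Φ.Y 1 Φ.E) = g11 at *
  generalize Φ.Y 0 Φ.E = E0 at *
  generalize Φ.Y 1 Φ.E = E1 at *
  -- Expansion of F² g in the orthogonal coframe given by dE and the rotated y. With it the trace of
  -- g⁻¹ V(g), which is 2I, reduces to its component along u, the y-components being zero.
  have q00 : Φ.F * Φ.F * g00 = E0 ^ 2 + Φ.y 1 ^ 2 * (Φ.s * Φ.s) := by
    rw [hF, hs, ← h0, ← h1]; ring
  have q01 : Φ.F * Φ.F * g01 = E0 * E1 - Φ.y 0 * Φ.y 1 * (Φ.s * Φ.s) := by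
    rw [hF, hs, ← h0, ← h1]; ring
  have q11 : Φ.F * Φ.F * g11 = E1 ^ 2 + Φ.y 0 ^ 2 * (Φ.s * Φ.s) := by
    rw [hF, hs, ← h0, ← h1]; ring
  have r : 2 * (Φ.F * Φ.F) * Φ.I * (Φ.s * Φ.s) =
      V00 * E1 ^ 2 - 2 * V01 * (E0 * E1) + V11 * E0 ^ 2 := by
    linear_combination Φ.F * Φ.F * hd + V00 * q11 + V11 * q00 - 2 * V01 * q01 +
      Φ.s * Φ.s * (Φ.y 0 * v0 + Φ.y 1 * v1)
  linear_combination Φ.s' ^ 2 * r -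
    2 * (Φ.F * Φ.F) * Φ.I * (1 + Φ.s * Φ.s') * hi

end FinslerAlgebra

/-! ### Smooth functions on an open set and their directional derivations. -/

section SmoothFunctions

open TopologicalSpace

variable {E : Type*} [NormedAddCommGroup E] [NormedSpace ℝ E]

/-- The algebra of smooth functions on an open set. -/
def smoothFun (D : Opens E) : Subalgebra ℝ (D → ℝ) where
  -- The values of φ off D are arbitrary; elements of the algebra are functions on the subtype, so
  -- equality there is equality on D.
  carrier := {u | ∃ φ : E → ℝ, ContDiffOn ℝ ∞ φ D ∧ ∀ p : D, φ p = u p}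
  mul_mem' := by
    rintro _ _ ⟨φ, hφ, h⟩ ⟨ψ, hψ, k⟩
    exact ⟨fun p => φ p * ψ p, hφ.mul hψ, fun p => by simp [h, k]⟩
  add_mem' := by
    rintro _ _ ⟨φ, hφ, h⟩ ⟨ψ, hψ, k⟩
    exact ⟨fun p => φ p + ψ p, hφ.add hψ, fun p => by simp [h, k]⟩
  algebraMap_mem' c := ⟨fun _ => c, contDiffOn_const, fun _ => rfl⟩

variable {D : Opens E}

/-- The function `φ` on the ambient space restricts to the smooth function `u` on `D`. -/
def Restricts (φ : E → ℝ) (u : smoothFun D) : Prop := ∀ p : D, φ p = u.1 p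

lemma exists_restricts (u : smoothFun D) :
    ∃ φ : E → ℝ, ContDiffOn ℝ ∞ φ D ∧ Restricts φ u := u.2

lemma Restricts.contDiffOn {φ : E → ℝ} {u : smoothFun D} (h : Restricts φ u) :
    ContDiffOn ℝ ∞ φ D := by
  obtain ⟨ψ, hψ, k⟩ := exists_restricts u
  exact hψ.congr fun p hp => (h ⟨p, hp⟩).trans (k ⟨p, hp⟩).symm

lemma Restricts.contDiffAt {φ : E → ℝ} {u : smoothFun D} (h : Restricts φ u) (p : D) :
    ContDiffAt ℝ ∞ φ p := h.contDiffOn.contDiffAt (D.isOpen.mem_nhds p.2)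

lemma Restricts.differentiableAt {φ : E → ℝ} {u : smoothFun D} (h : Restricts φ u) (p : D) :
    DifferentiableAt ℝ φ p := (h.contDiffAt p).differentiableAt (by simp)

/-- Openness of D makes derivatives independent of the chosen extension, which is what lets
`dirDeriv` be defined by choice. -/
lemma Restricts.fderiv_eq {φ ψ : E → ℝ} {u : smoothFun D} (h : Restricts φ u)
    (k : Restricts ψ u) (p : D) : fderiv ℝ φ p = fderiv ℝ ψ p := by
  apply Filter.EventuallyEq.fderiv_eq
  filter_upwards [D.isOpen.mem_nhds p.2] with q hq
  exact (h ⟨q, hq⟩).trans (k ⟨q, hq⟩).symm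

lemma Restricts.unique {φ : E → ℝ} {u v : smoothFun D} (h : Restricts φ u)
    (k : Restricts φ v) : u = v :=
  Subtype.ext (funext fun p => (h p).symm.trans (k p))

lemma Restricts.apply_eq {φ ψ : E → ℝ} {u : smoothFun D} (h : Restricts φ u)
    (k : Restricts ψ u) (p : E) (hp : p ∈ D) : φ p = ψ p :=
  (h ⟨p, hp⟩).trans (k ⟨p, hp⟩).symm

/-- The restriction of a function that is smooth on `D`. -/
def restrict {φ : E → ℝ} (h : ContDiffOn ℝ ∞ φ D) : smoothFun D :=
  ⟨fun p => φ p, φ, h, fun _ => rfl⟩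

lemma restricts_restrict {φ : E → ℝ} (h : ContDiffOn ℝ ∞ φ D) : Restricts φ (restrict h) :=
  fun _ => rfl

lemma Restricts.congr {φ ψ : E → ℝ} {u : smoothFun D} (h : Restricts φ u)
    (k : ∀ p ∈ D, ψ p = φ p) : Restricts ψ u := fun p => (k p p.2).trans (h p)

lemma Restricts.add {φ ψ : E → ℝ} {u v : smoothFun D} (h : Restricts φ u) (k : Restricts ψ v) :
    Restricts (fun p => φ p + ψ p) (u + v) := fun p => by simp [h p, k p]

lemma Restricts.sub {φ ψ : E → ℝ} {u v : smoothFun D} (h : Restricts φ u) (k : Restricts ψ v) :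
    Restricts (fun p => φ p - ψ p) (u - v) := fun p => by simp [h p, k p]

lemma Restricts.sum {ι : Type*} [Fintype ι] {φ : ι → E → ℝ} {u : ι → smoothFun D}
    (h : ∀ i, Restricts (φ i) (u i)) : Restricts (fun p => ∑ i, φ i p) (∑ i, u i) := fun p => by
  simp [h _ p]

lemma Restricts.neg {φ : E → ℝ} {u : smoothFun D} (h : Restricts φ u) :
    Restricts (fun p => -φ p) (-u) := fun p => by simp [h p]

lemma Restricts.mul {φ ψ : E → ℝ} {u v : smoothFun D} (h : Restricts φ u) (k : Restricts ψ v) :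
    Restricts (fun p => φ p * ψ p) (u * v) := fun p => by simp [h p, k p]

lemma Restricts.two_mul {φ : E → ℝ} {u : smoothFun D} (h : Restricts φ u) :
    Restricts (fun p => 2 * φ p) (2 * u) := fun p => by
  have := h p
  simp only [_root_.two_mul, this]
  rfl

lemma Restricts.smul {φ : E → ℝ} {u : smoothFun D} (c : ℝ) (h : Restricts φ u) :
    Restricts (fun p => c * φ p) (c • u) := fun p => by simp [h p]

lemma contDiffOn_fderiv_apply {φ : E → ℝ} (h : ContDiffOn ℝ ∞ φ D) (w : E) :
    ContDiffOn ℝ ∞ (fun p => fderiv ℝ φ p w) D :=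
  (h.fderiv_of_isOpen D.isOpen (m := ∞) (by simp)).clm_apply contDiffOn_const

/-- The derivative of a smooth function in the direction `w`. -/
noncomputable def dirDeriv (w : E) : Derivation ℝ (smoothFun D) (smoothFun D) :=
  Derivation.mk'
    { toFun := fun u => restrict (contDiffOn_fderiv_apply (exists_restricts u).choose_spec.1 w)
      map_add' := by
        intro u v
        refine Subtype.ext (funext fun p => ?_)
        have hu := (exists_restricts u).choose_spec.2
        have hv := (exists_restricts v).choose_spec.2
        have h := (exists_restricts (u + v)).choose_spec.2.fderiv_eq (hu.add hv) p
        have := fderiv_fun_add (hu.differentiableAt p) (hv.differentiableAt p)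
        simp [restrict, h, this]
      map_smul' := by
        intro c u
        refine Subtype.ext (funext fun p => ?_)
        have hu := (exists_restricts u).choose_spec.2
        have h := (exists_restricts (c • u)).choose_spec.2.fderiv_eq (hu.smul c) p
        have := fderiv_const_mul (hu.differentiableAt p) c
        simp [restrict, h, this] }
    (by
      intro u v
      refine Subtype.ext (funext fun p => ?_)
      have hu := (exists_restricts u).choose_spec.2
      have hv := (exists_restricts v).choose_spec.2
      have h := (exists_restricts (u * v)).choose_spec.2.fderiv_eq (hu.mul hv) p
      have := fderiv_fun_mul (hu.differentiableAt p) (hv.differentiableAt p)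
      simp [restrict, h, this, hu p, hv p])

lemma Restricts.dirDeriv {φ : E → ℝ} {u : smoothFun D} (h : Restricts φ u) (w : E) :
    Restricts (fun p => fderiv ℝ φ p w) (dirDeriv w u) := fun p => by
  change fderiv ℝ φ p w = _
  rw [h.fderiv_eq (exists_restricts u).choose_spec.2 p]
  rfl

/-- Schwarz's theorem. -/
lemma dirDeriv_comm (w w' : E) (u : smoothFun D) :
    dirDeriv w (dirDeriv w' u) = dirDeriv w' (dirDeriv w u) := by
  obtain ⟨φ, hφ, h⟩ := exists_restricts u
  refine Subtype.ext (funext fun p => ?_)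
  rw [← ((h.dirDeriv w').dirDeriv w) p, ← ((h.dirDeriv w).dirDeriv w') p]
  have hd : DifferentiableAt ℝ (fderiv ℝ φ) p :=
    ((h.contDiffAt p).fderiv_right (m := 1)
      (by norm_cast)).differentiableAt (by simp)
  have hsymm : IsSymmSndFDerivAt ℝ φ p := (h.contDiffAt p).isSymmSndFDerivAt (by
    rw [minSmoothness_of_isRCLikeNormedField]; norm_cast)
  simp only [fderiv_clm_apply hd (differentiableAt_const _)]
  simpa using hsymm.eq w w'

lemma restricts_inv {φ : E → ℝ} {u : smoothFun D} (h : Restricts φ u) (h0 : ∀ p ∈ D, φ p ≠ 0) :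
    Restricts (fun p => (φ p)⁻¹) (restrict (h.contDiffOn.inv h0)) := restricts_restrict _

end SmoothFunctions

/-! ### The Finsler structure on the algebra of smooth functions. -/

section LocalTheory

open TopologicalSpace

/-- The local properties of a Finsler function of a surface. -/
structure IsFinslerOn (f : TCoord 2 → ℝ) (D : Opens (TCoord 2)) : Prop where
  smooth : ContDiffOn ℝ ∞ f D
  pos : ∀ p ∈ D, 0 < f p
  euler : ∀ p ∈ D, p.2 0 * dY 0 f p + p.2 1 * dY 1 f p = f p
  det_pos : ∀ p ∈ D, 0 < (metric f p).det

variable {f : TCoord 2 → ℝ} {D : Opens (TCoord 2)}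

/-- The derivation `∂/∂xⁱ` of the smooth functions. -/
noncomputable def partialX (D : Opens (TCoord 2)) (i : Fin 2) :
    Derivation ℝ (smoothFun D) (smoothFun D) := dirDeriv (EuclideanSpace.single i 1, 0)

/-- The derivation `∂/∂yⁱ` of the smooth functions. -/
noncomputable def partialY (D : Opens (TCoord 2)) (i : Fin 2) :
    Derivation ℝ (smoothFun D) (smoothFun D) := dirDeriv (0, EuclideanSpace.single i 1)

lemma Restricts.dX {φ : TCoord 2 → ℝ} {u : smoothFun D} (h : Restricts φ u) (i : Fin 2) :
    Restricts (dX i φ) (partialX D i u) := h.dirDeriv _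

lemma Restricts.dY {φ : TCoord 2 → ℝ} {u : smoothFun D} (h : Restricts φ u) (i : Fin 2) :
    Restricts (dY i φ) (partialY D i u) := h.dirDeriv _

/-- The coordinate function `xⁱ`. -/
noncomputable def coordX (D : Opens (TCoord 2)) (i : Fin 2) : smoothFun D :=
  restrict (φ := ⇑((EuclideanSpace.proj i : EuclideanSpace ℝ (Fin 2) →L[ℝ] ℝ).comp
    (ContinuousLinearMap.fst ℝ _ (EuclideanSpace ℝ (Fin 2)))))
    (ContinuousLinearMap.contDiff _).contDiffOn

/-- The coordinate function `yⁱ`. -/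
noncomputable def coordY (D : Opens (TCoord 2)) (i : Fin 2) : smoothFun D :=
  restrict (φ := ⇑((EuclideanSpace.proj i : EuclideanSpace ℝ (Fin 2) →L[ℝ] ℝ).comp
    (ContinuousLinearMap.snd ℝ (EuclideanSpace ℝ (Fin 2)) _)))
    (ContinuousLinearMap.contDiff _).contDiffOn

lemma restricts_coordY (i : Fin 2) : Restricts (fun p => p.2 i) (coordY D i) := fun _ => rfl

lemma dirDeriv_coordX (i : Fin 2) (w : TCoord 2) (p : D) :
    (dirDeriv w (coordX D i)).1 p = w.1 i := by
  refine ((restricts_restrict _).dirDeriv w p).symm.trans ?_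
  simp

lemma dirDeriv_coordY (i : Fin 2) (w : TCoord 2) (p : D) :
    (dirDeriv w (coordY D i)).1 p = w.2 i := by
  refine ((restricts_restrict _).dirDeriv w p).symm.trans ?_
  simp

lemma Restricts.lieD {φ : TCoord 2 → ℝ} {u : smoothFun D} (h : Restricts φ u)
    (Z : TCoord 2 → TCoord 2) (p : D) : lieD Z φ p =
      (Z p).1 0 * (partialX D 0 u).1 p + (Z p).1 1 * (partialX D 1 u).1 p +
      (Z p).2 0 * (partialY D 0 u).1 p + (Z p).2 1 * (partialY D 1 u).1 p := by
  rw [← h.dX 0 p, ← h.dX 1 p, ← h.dY 0 p, ← h.dY 1 p]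
  simp only [Finsler.lieD, Finsler.dX, Finsler.dY]
  have e : Z p = (Z p).1 0 • ((EuclideanSpace.single 0 1, 0) : TCoord 2) +
      (Z p).1 1 • ((EuclideanSpace.single 1 1, 0) : TCoord 2) +
      (Z p).2 0 • ((0, EuclideanSpace.single 0 1) : TCoord 2) +
      (Z p).2 1 • ((0, EuclideanSpace.single 1 1) : TCoord 2) := by
    ext i <;> fin_cases i <;> simp
  conv_lhs => rw [e]
  simp only [map_add, map_smul, smul_eq_mul]

lemma smoothFun_ext {u v : smoothFun D} (h : ∀ p : D, u.1 p = v.1 p) : u = v :=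
  Subtype.ext (funext h)

namespace IsFinslerOn

variable (h : IsFinslerOn f D)
include h

lemma restricts_f : Restricts f (restrict h.smooth) := restricts_restrict _

lemma restricts_energy : Restricts (energy f)
    ((1 / 2 : ℝ) • (restrict h.smooth * restrict h.smooth)) :=
  ((h.restricts_f.mul h.restricts_f).smul (1 / 2)).congr fun p _ => by
    simp only [energy]; ring

lemma restricts_metric (i j : Fin 2) : Restricts (fun p => metric f p i j)
    (partialY D i (partialY D j ((1 / 2 : ℝ) • (restrict h.smooth * restrict h.smooth)))) :=
  (h.restricts_energy.dY j).dY i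

lemma metric_symm (i j : Fin 2) (p : TCoord 2) (hp : p ∈ D) :
    metric f p i j = metric f p j i :=
  (h.restricts_metric i j ⟨p, hp⟩).trans <| by
    rw [show partialY D i (partialY D j _) = partialY D j (partialY D i _) from dirDeriv_comm _ _ _]
    exact (h.restricts_metric j i ⟨p, hp⟩).symm

lemma contDiffOn_det : ContDiffOn ℝ ∞ (fun p => (metric f p).det) D := by
  simp only [Matrix.det_fin_two]
  exact (((h.restricts_metric 0 0).mul (h.restricts_metric 1 1)).sub
    ((h.restricts_metric 0 1).mul (h.restricts_metric 1 0))).contDiffOn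

lemma contDiffOn_sqrt_det : ContDiffOn ℝ ∞ (fun p => √(metric f p).det) D :=
  h.contDiffOn_det.sqrt fun p hp => (h.det_pos p hp).ne'

lemma contDiffOn_inv (i j : Fin 2) : ContDiffOn ℝ ∞ (fun p => (metric f p)⁻¹ i j) D := by
  have hd := h.contDiffOn_det.inv fun p hp => (h.det_pos p hp).ne'
  have hg := fun i j => (h.restricts_metric i j).contDiffOn
  simp only [Matrix.inv_def, Matrix.adjugate_fin_two, Ring.inverse_eq_inv']
  fin_cases i <;> fin_cases j <;>
    simp only [Matrix.smul_apply, smul_eq_mul, Matrix.of_apply, Matrix.cons_val',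
      Matrix.cons_val_zero, Matrix.cons_val_one, Matrix.cons_val_fin_one, Fin.zero_eta, Fin.mk_one, Fin.isValue]
  · exact hd.mul (hg 1 1)
  · exact hd.mul (hg 0 1).neg
  · exact hd.mul (hg 1 0).neg
  · exact hd.mul (hg 0 0)

lemma contDiffOn_sprayCoeff (i : Fin 2) : ContDiffOn ℝ ∞ (sprayCoeff f i) D := by
  have hx := fun j => (h.restricts_energy.dX j).contDiffOn
  have hxy := fun k j => ((h.restricts_energy.dY j).dX k).contDiffOn
  have hy := fun j => (restricts_coordY (D := D) j).contDiffOn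
  refine contDiffOn_const.mul (ContDiffOn.sum fun j _ => (h.contDiffOn_inv i j).mul
    (ContDiffOn.sub (ContDiffOn.sum fun k _ => (hy k).mul (hxy k j)) (hx j)))

/-- Multiplying by g turns the formula with g⁻¹ into the linear system by which the algebraic model
specifies G. -/
lemma metric_mul_sprayCoeff (p : TCoord 2) (hp : p ∈ D) (j : Fin 2) :
    2 * (metric f p j 0 * sprayCoeff f 0 p + metric f p j 1 * sprayCoeff f 1 p) =
      p.2 0 * dX 0 (dY j (energy f)) p + p.2 1 * dX 1 (dY j (energy f)) p - dX j (energy f) p := by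
  have hu : IsUnit (metric f p).det := (h.det_pos p hp).ne'.isUnit
  have hm := Matrix.mul_nonsing_inv _ hu
  have e := fun i k => congrFun (congrFun hm i) k
  simp only [Matrix.mul_apply, Fin.sum_univ_two, Matrix.one_apply] at e
  have e0 := e j 0
  have e1 := e j 1
  simp only [sprayCoeff, Fin.sum_univ_two]
  generalize (metric f p)⁻¹ = g at *
  fin_cases j <;> simp only [Fin.zero_eta, Fin.mk_one, Fin.isValue, if_true, zero_ne_one,
    one_ne_zero, if_false] at e0 e1 ⊢ <;>
  linear_combination (p.2 0 * Finsler.dX 0 (Finsler.dY 0 (energy f)) p +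
      p.2 1 * Finsler.dX 1 (Finsler.dY 0 (energy f)) p - Finsler.dX 0 (energy f) p) * e0 +
    (p.2 0 * Finsler.dX 0 (Finsler.dY 1 (energy f)) p +
      p.2 1 * Finsler.dX 1 (Finsler.dY 1 (energy f)) p - Finsler.dX 1 (energy f) p) * e1

/-- The algebra of smooth functions on the slit tangent bundle with its Finsler structure. -/
noncomputable def algebra : FinslerAlgebra (smoothFun D) where
  X := partialX D
  Y := partialY D
  X_X _ _ := dirDeriv_comm _ _
  Y_X _ _ := dirDeriv_comm _ _
  Y_Y _ _ := dirDeriv_comm _ _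
  x := coordX D
  y := coordY D
  X_x i j := smoothFun_ext fun p => by
    refine (dirDeriv_coordX _ _ _).trans ?_
    split_ifs with hij <;> simp [hij]
  Y_x i j := smoothFun_ext fun p => (dirDeriv_coordX _ _ _).trans (by simp)
  X_y i j := smoothFun_ext fun p => (dirDeriv_coordY _ _ _).trans (by simp)
  Y_y i j := smoothFun_ext fun p => by
    refine (dirDeriv_coordY _ _ _).trans ?_
    split_ifs with hij <;> simp [hij]
  F := restrict h.smooth
  F' := restrict (h.smooth.inv fun p hp => (h.pos p hp).ne')
  F_mul_inv := smoothFun_ext fun p => mul_inv_cancel₀ (h.pos p p.2).ne'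
  euler := (((restricts_coordY 0).mul (h.restricts_f.dY 0)).add
    ((restricts_coordY 1).mul (h.restricts_f.dY 1))).unique (h.restricts_f.congr h.euler)
  E := (1 / 2 : ℝ) • (restrict h.smooth * restrict h.smooth)
  two_mul_E := by
    rw [two_mul, ← add_smul]; norm_num
  s := restrict h.contDiffOn_sqrt_det
  s' := restrict (h.contDiffOn_sqrt_det.inv fun p hp => (Real.sqrt_pos.2 (h.det_pos p hp)).ne')
  s_mul_inv := smoothFun_ext fun p => mul_inv_cancel₀ (Real.sqrt_pos.2 (h.det_pos p p.2)).ne'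
  s_mul_self := smoothFun_ext fun p => by
    refine (Real.mul_self_sqrt (h.det_pos p p.2).le).trans ?_
    rw [Matrix.det_fin_two, h.metric_symm 1 0 p p.2]
    exact (((h.restricts_metric 0 0).mul (h.restricts_metric 1 1)).sub
      ((h.restricts_metric 0 1).mul (h.restricts_metric 0 1))) p
  G i := restrict (h.contDiffOn_sprayCoeff i)
  two_mul_G j := by
    have hG := fun i => restricts_restrict (h.contDiffOn_sprayCoeff i)
    have h1 := (((h.restricts_metric 0 j).mul (hG 0)).add
      ((h.restricts_metric 1 j).mul (hG 1))).two_mul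
    have h2 := (((restricts_coordY 0).mul ((h.restricts_energy.dY j).dX 0)).add
      ((restricts_coordY 1).mul ((h.restricts_energy.dY j).dX 1))).sub (h.restricts_energy.dX j)
    refine h1.unique (h2.congr fun p hp => ?_)
    rw [← h.metric_mul_sprayCoeff p hp j, h.metric_symm 0 j p hp, h.metric_symm 1 j p hp]

end IsFinslerOn
end LocalTheory

/-! ### Translation between coordinate expressions and the algebraic model. -/

section LocalTheory

open TopologicalSpace

variable {f : TCoord 2 → ℝ} {D : Opens (TCoord 2)}

lemma lieD_eq {φ : TCoord 2 → ℝ} {u : smoothFun D} (hu : Restricts φ u)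
    (Z : TCoord 2 → TCoord 2) (p : TCoord 2) (hp : p ∈ D) : lieD Z φ p =
      (Z p).1 0 * dX 0 φ p + (Z p).1 1 * dX 1 φ p + (Z p).2 0 * dY 0 φ p + (Z p).2 1 * dY 1 φ p := by
  rw [hu.lieD Z ⟨p, hp⟩, ← hu.dX 0, ← hu.dX 1, ← hu.dY 0, ← hu.dY 1]

namespace IsFinslerOn

variable (h : IsFinslerOn f D)
include h

lemma restricts_F : Restricts f h.algebra.F := fun _ => rfl

lemma restricts_E : Restricts (energy f) h.algebra.E := h.restricts_energy

lemma restricts_s : Restricts (fun p => √(metric f p).det) h.algebra.s := fun _ => rfl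

lemma restricts_s' : Restricts (fun p => (√(metric f p).det)⁻¹) h.algebra.s' := fun _ => rfl

lemma restricts_G (i : Fin 2) : Restricts (sprayCoeff f i) (h.algebra.G i) := fun _ => rfl

lemma restricts_N (i j : Fin 2) : Restricts (connCoeff f i j) (h.algebra.N i j) :=
  (h.restricts_G i).dY j

lemma restricts_S {φ : TCoord 2 → ℝ} {u : smoothFun D} (hu : Restricts φ u) :
    Restricts (lieD (spray f) φ) (h.algebra.S u) := by
  rw [h.algebra.S_apply]
  have r := (((((restricts_coordY 0).mul (hu.dX 0)).add ((restricts_coordY 1).mul (hu.dX 1))).sub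
    ((h.restricts_G 0).two_mul.mul (hu.dY 0))).sub ((h.restricts_G 1).two_mul.mul (hu.dY 1)))
  refine r.congr fun p hp => ?_
  rw [lieD_eq hu _ p hp]
  simp only [spray]
  ring

lemma dY_energy (j : Fin 2) (p : TCoord 2) (hp : p ∈ D) : dY j (energy f) p = f p * dY j f p := by
  have r : Restricts _ (h.algebra.Y j h.algebra.E) := h.algebra.Y_E j ▸
    h.restricts_F.mul (h.restricts_F.dY j)
  exact (h.restricts_E.dY j).apply_eq r p hp

/-- The factor F in F m is absorbed by dE = F dF. -/
lemma restricts_u (i : Fin 2) :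
    Restricts (fun p => f p * unitNormal f p i) (h.algebra.u i) := by
  fin_cases i
  · refine (h.restricts_s'.mul (h.restricts_E.dY 1)).neg.congr fun p hp => ?_
    simp [unitNormal, h.dY_energy 1 p hp]; ring
  · refine (h.restricts_s'.mul (h.restricts_E.dY 0)).congr fun p hp => ?_
    simp [unitNormal, h.dY_energy 0 p hp]; ring

lemma restricts_V {φ : TCoord 2 → ℝ} {u : smoothFun D} (hu : Restricts φ u) :
    Restricts (lieD (frameV f) φ) (h.algebra.V u) := by
  rw [h.algebra.V_apply]
  refine (((h.restricts_u 0).mul (hu.dY 0)).add ((h.restricts_u 1).mul (hu.dY 1))).congr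
    fun p hp => ?_
  rw [lieD_eq hu _ p hp]
  simp [frameV]

lemma restricts_δ {φ : TCoord 2 → ℝ} {u : smoothFun D} (hu : Restricts φ u) (j : Fin 2) :
    Restricts (fun p => dX j φ p - connCoeff f 0 j p * dY 0 φ p - connCoeff f 1 j p * dY 1 φ p)
      (h.algebra.δ j u) := by
  rw [h.algebra.δ_apply]
  exact ((hu.dX j).sub ((h.restricts_N 0 j).mul (hu.dY 0))).sub
    ((h.restricts_N 1 j).mul (hu.dY 1))

lemma restricts_H {φ : TCoord 2 → ℝ} {u : smoothFun D} (hu : Restricts φ u) :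
    Restricts (lieD (frameH f) φ) (h.algebra.H u) := by
  rw [h.algebra.H_apply]
  refine (((h.restricts_u 0).mul (h.restricts_δ hu 0)).add
    ((h.restricts_u 1).mul (h.restricts_δ hu 1))).congr fun p hp => ?_
  rw [lieD_eq hu _ p hp]
  simp only [frameH, hlift, Fin.sum_univ_two, PiLp.smul_apply, smul_eq_mul]
  ring

lemma restricts_R (i j : Fin 2) : Restricts (jacobiEndo f i j) (h.algebra.R i j) := by
  refine (((((h.restricts_G i).dX j).two_mul).sub (h.restricts_S (h.restricts_N i j))).sub
    (((h.restricts_N i 0).mul (h.restricts_N 0 j)).add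
      ((h.restricts_N i 1).mul (h.restricts_N 1 j)))).congr fun p hp => ?_
  simp only [jacobiEndo, Fin.sum_univ_two]

lemma restricts_K : Restricts (flagCurvature f) h.algebra.K := by
  have hF' : Restricts (fun p => (f p)⁻¹) h.algebra.F' := fun _ => rfl
  refine (((h.restricts_R 0 0).add (h.restricts_R 1 1)).mul (hF'.mul hF')).congr fun p hp => ?_
  simp only [flagCurvature, Fin.sum_univ_two]
  field_simp

/-- In the algebra I is V(s)/s; `two_mul_F_mul_F_mul_I` identifies it with the Cartan contraction
after cancelling 2F². -/
lemma restricts_I : Restricts (mainScalar f) h.algebra.I := by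
  obtain ⟨φ, -, hφ⟩ := exists_restricts h.algebra.I
  have r := ((h.restricts_F.mul h.restricts_F).two_mul).mul hφ
  rw [h.algebra.two_mul_F_mul_F_mul_I] at r
  have r' := r.apply_eq (Restricts.sum fun i => Restricts.sum fun j => Restricts.sum fun k =>
    ((((((h.restricts_E.dY j).dY i).dY k).mul (h.restricts_u i)).mul (h.restricts_u j)).mul
      (h.restricts_u k)))
  refine hφ.congr fun p hp => ?_
  have hf := (h.pos p hp).ne'
  have e : 2 * (f p * f p) * φ p = 2 * (f p * f p) * mainScalar f p := by
    rw [r' p hp]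
    simp only [mainScalar, Finset.mul_sum, metric, Matrix.of_apply]
    refine Finset.sum_congr rfl fun i _ => Finset.sum_congr rfl fun j _ =>
      Finset.sum_congr rfl fun k _ => ?_
    ring
  exact (mul_left_cancel₀ (by positivity) e).symm

lemma landsberg (hL : ∀ p ∈ D, ∀ i j k, landsbergTensor f i j k p = 0) : h.algebra.Landsberg := by
  intro i j k
  have hG := fun l => (((h.restricts_G l).dY k).dY j).dY i
  refine (((hG 0).mul (h.restricts_E.dY 0)).add ((hG 1).mul (h.restricts_E.dY 1))).unique
    (Restricts.congr (φ := fun _ => 0) (fun p => rfl) fun p hp => ?_)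
  have e := hL p hp i j k
  simp only [landsbergTensor, Fin.sum_univ_two] at e
  have e' := (mul_eq_zero.1 e).resolve_left
    (mul_ne_zero (by norm_num) (h.pos p hp).ne')
  rw [h.dY_energy 0 p hp, h.dY_energy 1 p hp]
  linear_combination f p * e'

/-- The Jacobi endomorphism of a surface is determined by the flag curvature. -/
lemma jacobiEndo_eq (p : TCoord 2) (hp : p ∈ D) (i j : Fin 2) : jacobiEndo f i j p =
    flagCurvature f p * (f p ^ 2 * (if i = j then 1 else 0) - f p * Finsler.dY j f p * p.2 i) := by
  have hd : Restricts (fun _ => if i = j then 1 else 0) (if i = j then 1 else 0 : smoothFun D) := by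
    split_ifs <;> exact fun _ => rfl
  have r := h.restricts_K.mul (((h.restricts_F.mul h.restricts_F).mul hd).sub
    ((h.restricts_F.mul (h.restricts_F.dY j)).mul (restricts_coordY i)))
  rw [pow_two]
  exact (h.restricts_R i j).apply_eq (h.algebra.R_eq i j ▸ r) p hp

/-- `½ log (det g)` is a potential of the main scalar along the vertical field. -/
lemma lieD_frameV_log_det (p : TCoord 2) (hp : p ∈ D) :
    lieD (frameV f) (fun p => Real.log √(metric f p).det) p = mainScalar f p := by
  have hs := Real.sqrt_pos.2 (h.det_pos p hp)
  have hd := h.restricts_s.differentiableAt ⟨p, hp⟩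
  have e := (h.restricts_V h.restricts_s).apply_eq
    (h.algebra.V_s ▸ h.restricts_I.mul h.restricts_s) p hp
  rw [lieD, (hd.hasFDerivAt.log hs.ne').fderiv]
  simp only [smul_apply, smul_eq_mul]
  rw [lieD] at e
  rw [e]
  field_simp

lemma contDiffOn_log_det : ContDiffOn ℝ ∞ (fun p => Real.log √(metric f p).det) D :=
  h.contDiffOn_sqrt_det.log fun p hp => (Real.sqrt_pos.2 (h.det_pos p hp)).ne'

/-- The flag curvature of a Landsberg surface along the vertical field. -/
lemma lieD_frameV_flagCurvature (hL : ∀ p ∈ D, ∀ i j k, landsbergTensor f i j k p = 0)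
    (p : TCoord 2) (hp : p ∈ D) :
    lieD (frameV f) (flagCurvature f) p = -(mainScalar f p * flagCurvature f p) :=
  (h.restricts_V h.restricts_K).apply_eq
    (h.algebra.V_K (h.landsberg hL) ▸ (h.restricts_I.mul h.restricts_K).neg) p hp

/-- The identity satisfied by the logarithmic derivative of the flag curvature of a Landsberg
surface along the spray. -/
lemma logDeriv_flagCurvature_identity (hL : ∀ p ∈ D, ∀ i j k, landsbergTensor f i j k p = 0)
    (hK : ∀ p ∈ D, flagCurvature f p ≠ 0) (p : TCoord 2) (hp : p ∈ D) :
    let β : TCoord 2 → ℝ := fun p => lieD (spray f) (flagCurvature f) p * (flagCurvature f p)⁻¹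
    β p + mainScalar f p * lieD (frameV f) β p + lieD (frameH f) (mainScalar f) p +
      lieD (frameV f) (lieD (frameV f) β) p = 0 := by
  intro β
  obtain ⟨K', hK'⟩ : ∃ K' : smoothFun D, Restricts (fun p => (flagCurvature f p)⁻¹) K' :=
    ⟨_, restricts_inv h.restricts_K hK⟩
  have hKK : h.algebra.K * K' = 1 := smoothFun_ext fun q =>
    (h.restricts_K.mul hK' q).symm.trans (mul_inv_cancel₀ (hK q q.2))
  have hβ : Restricts β (h.algebra.S h.algebra.K * K') := (h.restricts_S h.restricts_K).mul hK'
  have e := h.algebra.beta_identity (h.landsberg hL) hKK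
    (β := h.algebra.S h.algebra.K * K') (by linear_combination h.algebra.S h.algebra.K * hKK)
  generalize h.algebra.S h.algebra.K * K' = b at hβ e
  have r := ((hβ.add (h.restricts_I.mul (h.restricts_V hβ))).add
    (h.restricts_H h.restricts_I)).add (h.restricts_V (h.restricts_V hβ))
  rw [e] at r
  exact r ⟨p, hp⟩

end IsFinslerOn
end LocalTheory

/-! ### Integrals along a vector field versus potentials. -/

section Integrals

open Set MeasureTheory

variable {n : ℕ}

/-- The fundamental theorem of calculus along integral curves. -/
lemma isIntegralAlong_of_lieD_eq {X : TCoord n → TCoord n} {φ A : TCoord n → ℝ}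
    {U : Set (TCoord n)} (hU : IsOpen U) (hA : ContDiffOn ℝ ∞ A U) (hφ : ContinuousOn φ U)
    (h : ∀ p ∈ U, lieD X A p = φ p) : IsIntegralAlong X φ A U where
  smooth := hA
  integral_eq a b γ hab hγ := by
    have hc : ContinuousOn γ (Icc a b) := fun t ht => (hγ t ht).2.continuousWithinAt
    have hm : MapsTo γ (Icc a b) U := fun t ht => (hγ t ht).1
    refine (intervalIntegral.integral_eq_sub_of_hasDeriv_right_of_le
      (f := fun t => A (γ t)) hab (hA.continuousOn.comp hc hm) (fun t ht => ?_) ?_).symm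
    · have ht' := Ioo_subset_Icc_self ht
      have hd : DifferentiableAt ℝ A (γ t) :=
        (hA.contDiffAt (hU.mem_nhds (hm ht'))).differentiableAt (by simp)
      have hg : HasDerivAt γ (X (γ t)) t :=
        (hγ t ht').2.hasDerivAt (Icc_mem_nhds ht.1 ht.2)
      rw [← h _ (hm ht')]
      exact (hd.hasFDerivAt.comp_hasDerivAt t hg).hasDerivWithinAt
    · exact ContinuousOn.intervalIntegrable_of_Icc hab (hφ.comp hc hm)

/-- An integral along a vector field is a potential along that vector field. -/
lemma IsIntegralAlong.lieD_eq {X : TCoord n → TCoord n} {φ A : TCoord n → ℝ}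
    {U : Set (TCoord n)} (h : IsIntegralAlong X φ A U) (hU : IsOpen U) (hX : ContDiffOn ℝ 1 X U)
    (hφ : ContinuousOn φ U) (p : TCoord n) (hp : p ∈ U) : lieD X A p = φ p := by
  -- Picard-Lindelöf: an integral curve through p at time 0.
  obtain ⟨r, hr, ε, hε, hα⟩ := (hX.contDiffAt (hU.mem_nhds hp)
    ).exists_forall_mem_closedBall_exists_eq_forall_mem_Ioo_hasDerivAt 0
  obtain ⟨α, hα0, hα⟩ := hα p (Metric.mem_closedBall_self hr.le)
  simp only [zero_sub, zero_add] at hα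
  have h0 : HasDerivAt α (X (α 0)) 0 := hα 0 ⟨by linarith, hε⟩
  have hU' : α ⁻¹' U ∈ nhds (0 : ℝ) :=
    h0.continuousAt.preimage_mem_nhds (hU.mem_nhds (by rwa [hα0]))
  obtain ⟨δ, hδ, hδU⟩ := Metric.mem_nhds_iff.1 hU'
  set η := min (ε / 2) (δ / 2) with hη
  have hη0 : 0 < η := lt_min (by linarith) (by linarith)
  have hηε : η < ε := (min_le_left _ _).trans_lt (by linarith)
  have hηδ : η < δ := (min_le_right _ _).trans_lt (by linarith)
  have hmem : ∀ t ∈ Icc 0 η, α t ∈ U := fun t ht => hδU (by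
    rw [Metric.mem_ball, Real.dist_eq, sub_zero, abs_of_nonneg ht.1]; linarith [ht.2])
  have hder : ∀ t ∈ Icc 0 η, HasDerivAt α (X (α t)) t := fun t ht =>
    hα t ⟨by linarith [ht.1], by linarith [ht.2]⟩
  have hcont : ContinuousOn (fun t => φ (α t)) (Icc 0 η) :=
    hφ.comp (fun t ht => (hder t ht).continuousAt.continuousWithinAt) hmem
  have hint : ∀ t ∈ Icc 0 η, A (α t) = A (α 0) + ∫ s in (0 : ℝ)..t, φ (α s) := fun t ht => by
    rw [← h.integral_eq 0 t α ht.1 fun s hs => ⟨hmem s ⟨hs.1, hs.2.trans ht.2⟩,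
      (hder s ⟨hs.1, hs.2.trans ht.2⟩).hasDerivWithinAt⟩]
    ring
  -- The integral condition is applied on intervals starting at 0, so right derivatives at 0 are
  -- compared; they determine the value.
  have hIcc : Icc 0 η ∈ nhdsWithin (0 : ℝ) (Ici 0) := Icc_mem_nhdsGE hη0
  have hIoi : Icc 0 η ∈ nhdsWithin (0 : ℝ) (Ioi 0) := nhdsWithin_mono _ Ioi_subset_Ici_self hIcc
  have hd : DifferentiableAt ℝ A (α 0) :=
    (h.smooth.contDiffAt (hU.mem_nhds (by rwa [hα0]))).differentiableAt (by simp)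
  have h1 : HasDerivWithinAt (fun t => A (α t)) (fderiv ℝ A (α 0) (X (α 0))) (Ici 0) 0 :=
    (hd.hasFDerivAt.comp_hasDerivAt 0 h0).hasDerivWithinAt
  have h2 : HasDerivWithinAt (fun t => ∫ s in (0 : ℝ)..t, φ (α s)) (φ (α 0)) (Ici 0) 0 := by
    refine intervalIntegral.integral_hasDerivWithinAt_right (t := Ioi 0) (by simp) ?_ ?_
    · exact ⟨Icc 0 η, hIoi, hcont.aestronglyMeasurable measurableSet_Icc⟩
    · exact ((hcont 0 ⟨le_rfl, hη0.le⟩).mono_of_mem_nhdsWithin hIcc).mono Ioi_subset_Ici_self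
  have h3 : HasDerivWithinAt (fun t => A (α t)) (φ (α 0)) (Ici 0) 0 := by
    refine (h2.const_add (A (α 0))).congr_of_eventuallyEq ?_ (hint 0 ⟨le_rfl, hη0.le⟩)
    filter_upwards [hIcc] with t ht using hint t ht
  have := (uniqueDiffWithinAt_Ici (0 : ℝ)).eq_deriv _ h1 h3
  rwa [hα0] at this

end Integrals

/-! ### Positivity of the determinant of the metric. -/

section Convexity

open Set TopologicalSpace

/-- The second derivative at a local minimum is nonnegative. -/
lemma deriv_deriv_nonneg_of_isLocalMin {h : ℝ → ℝ} {a : ℝ} (hm : IsLocalMin h a)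
    (hc : ContinuousAt h a) : 0 ≤ deriv (deriv h) a := by
  by_contra! hneg
  -- A negative second derivative would make a a local maximum as well, so h would be locally
  -- constant.
  have hM := isLocalMax_of_deriv_deriv_neg hneg hm.deriv_eq_zero hc
  have he : h =ᶠ[nhds a] fun _ => h a := by
    filter_upwards [hm, hM] with t h1 h2 using le_antisymm h2 h1
  have he' := he.deriv.deriv_eq
  simp only [deriv_const'] at he'
  exact hneg.ne he'

variable {f : TCoord 2 → ℝ} {D : Opens (TCoord 2)}

/-- Differentiation along a line in the fibre. -/
lemma hasDerivAt_fibre_line {φ : TCoord 2 → ℝ} (hφ : ContDiffOn ℝ ∞ φ D)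
    (x y v : EuclideanSpace ℝ (Fin 2)) (t : ℝ) (ht : (x, y + t • v) ∈ D) : HasDerivAt (fun s => φ (x, y + s • v))
      (v 0 * dY 0 φ (x, y + t • v) + v 1 * dY 1 φ (x, y + t • v)) t := by
  have hl : HasDerivAt (fun s : ℝ => ((x, y + s • v) : TCoord 2)) (0, v) t := by
    refine (hasDerivAt_const t x).prodMk ?_
    simpa using ((hasDerivAt_id t).smul_const v).const_add y
  have hd : DifferentiableAt ℝ φ (x, y + t • v) :=
    (hφ.contDiffAt (D.isOpen.mem_nhds ht)).differentiableAt (by simp)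
  have e := lieD_eq (restricts_restrict hφ) (fun _ => (0, v)) _ ht
  simp only [PiLp.zero_apply, zero_mul, zero_add] at e
  rw [← e]
  exact hd.hasFDerivAt.comp_hasDerivAt t hl

lemma euler_of_homogeneous (hf : ContDiffOn ℝ ∞ f D) (p : TCoord 2) (hp : p ∈ D)
    (hom : ∀ c : ℝ, 0 < c → f (p.1, c • p.2) = c * f p) :
    p.2 0 * dY 0 f p + p.2 1 * dY 1 f p = f p := by
  have h1 := hasDerivAt_fibre_line hf p.1 p.2 p.2 0 (by simpa using hp)
  simp only [zero_smul, add_zero, Prod.mk.eta] at h1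
  have h2 : HasDerivAt (fun s : ℝ => (1 + s) * f p) (f p) 0 := by
    simpa using ((hasDerivAt_id (0 : ℝ)).const_add 1).mul_const (f p)
  refine h1.unique (h2.congr_of_eventuallyEq ?_)
  filter_upwards [lt_mem_nhds (show (-1 : ℝ) < 0 by norm_num)] with s hs
  rw [← hom (1 + s) (by linarith), add_smul, one_smul]

/-- The Hessian of the energy at a minimum of `F` on the unit circle of the fibre. -/
lemma metric_ge_of_isMin (hf : ContDiffOn ℝ ∞ f D) (x y v : EuclideanSpace ℝ (Fin 2))
    (hD : ∀ z : EuclideanSpace ℝ (Fin 2), z ≠ 0 → (x, z) ∈ D) (hy : ‖y‖ = 1)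
    (hmin : ∀ z, z ≠ 0 → f (x, y) ^ 2 * ‖z‖ ^ 2 ≤ f (x, z) ^ 2) :
    f (x, y) ^ 2 * ‖v‖ ^ 2 ≤ v 0 * (v 0 * metric f (x, y) 0 0 + v 1 * metric f (x, y) 1 0) +
      v 1 * (v 0 * metric f (x, y) 0 1 + v 1 * metric f (x, y) 1 1) := by
  set c := f (x, y) ^ 2
  have hE : ContDiffOn ℝ ∞ (energy f) D := (hf.pow 2).div_const 2
  have hEY := fun j => ((restricts_restrict hE).dY j).contDiffOn
  have hev : ∀ᶠ t : ℝ in nhds 0, y + t • v ≠ 0 := by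
    have hc : ContinuousAt (fun t : ℝ => y + t • v) 0 := by fun_prop
    refine hc.eventually_ne ?_
    rw [zero_smul, add_zero, ← norm_pos_iff, hy]
    exact one_pos
  have hy0 : y ≠ 0 := by rw [← norm_pos_iff, hy]; exact one_pos
  -- The energy minus (c/2)‖·‖² along the line: nonnegative off the origin of the fibre, and zero at
  -- t = 0 because ‖y‖ = 1.
  let h : ℝ → ℝ := fun t =>
    energy f (x, y + t • v) - c / 2 * ((y 0 + t * v 0) ^ 2 + (y 1 + t * v 1) ^ 2)
  have hn : ∀ z : EuclideanSpace ℝ (Fin 2), ‖z‖ ^ 2 = z 0 ^ 2 + z 1 ^ 2 := fun z => by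
    simp [EuclideanSpace.norm_sq_eq]
  have hlin : ∀ (i : Fin 2) (t : ℝ), HasDerivAt (fun s => y i + s * v i) (v i) t := fun i t => by
    simpa using ((hasDerivAt_id t).mul_const (v i)).const_add (y i)
  have hder : ∀ t, y + t • v ≠ 0 → HasDerivAt h
      (v 0 * dY 0 (energy f) (x, y + t • v) + v 1 * dY 1 (energy f) (x, y + t • v) -
        c * ((y 0 + t * v 0) * v 0 + (y 1 + t * v 1) * v 1)) t := fun t ht => by
    refine ((hasDerivAt_fibre_line hE x y v t (hD _ ht)).sub
      ((((hlin 0 t).pow 2).add ((hlin 1 t).pow 2)).const_mul (c / 2))).congr_deriv ?_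
    simp
    ring
  have hder2 : HasDerivAt (deriv h)
      (v 0 * (v 0 * metric f (x, y) 0 0 + v 1 * metric f (x, y) 1 0) +
        v 1 * (v 0 * metric f (x, y) 0 1 + v 1 * metric f (x, y) 1 1) - c * ‖v‖ ^ 2) 0 := by
    have h0 : (x, y + (0 : ℝ) • v) ∈ D := hD _ (by simpa using hy0)
    have e : deriv h =ᶠ[nhds 0] _ := hev.mono fun t ht => (hder t ht).deriv
    refine HasDerivAt.congr_of_eventuallyEq ?_ e
    refine ((((hasDerivAt_fibre_line (hEY 0) x y v 0 h0).const_mul (v 0)).add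
      ((hasDerivAt_fibre_line (hEY 1) x y v 0 h0).const_mul (v 1))).sub
      ((((hlin 0 0).mul_const (v 0)).add ((hlin 1 0).mul_const (v 1))).const_mul c)).congr_deriv ?_
    simp only [metric, Matrix.of_apply, hn, zero_smul, add_zero]
    ring
  have hmin' : IsLocalMin h 0 := by
    filter_upwards [hev] with t ht
    have e1 := hmin _ ht
    have e2 := hn y
    rw [hn] at e1
    rw [hy] at e2
    simp only [PiLp.add_apply, PiLp.smul_apply, smul_eq_mul] at e1
    simp only [h, energy, zero_smul, add_zero, zero_mul]
    rw [← e2]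
    simp only [c] at *
    linarith
  have := deriv_deriv_nonneg_of_isLocalMin hmin' (hder 0 (by simpa using hy0)).continuousAt
  rw [hder2.deriv] at this
  linarith

/-- A positive homogeneous function on the plane with nondegenerate metric tensor has a metric
tensor of positive determinant. -/
lemma det_metric_pos (hf : ContDiffOn ℝ ∞ f D) (x : EuclideanSpace ℝ (Fin 2))
    (hD : ∀ z : EuclideanSpace ℝ (Fin 2), z ≠ 0 → (x, z) ∈ D)
    (hpos : ∀ z : EuclideanSpace ℝ (Fin 2), z ≠ 0 → 0 < f (x, z))
    (hom : ∀ z : EuclideanSpace ℝ (Fin 2), z ≠ 0 → ∀ c : ℝ, 0 < c → f (x, c • z) = c * f (x, z))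
    (hdet : ∀ z : EuclideanSpace ℝ (Fin 2), z ≠ 0 → (metric f (x, z)).det ≠ 0)
    (y : EuclideanSpace ℝ (Fin 2)) (hy : y ≠ 0) : 0 < (metric f (x, y)).det := by
  have hE : ContDiffOn ℝ ∞ (energy f) D := (hf.pow 2).div_const 2
  have hg : ∀ i j, ContDiffOn ℝ ∞ (fun p => metric f p i j) D := fun i j =>
    (((restricts_restrict hE).dY j).dY i).contDiffOn
  have hl : MapsTo (fun z : EuclideanSpace ℝ (Fin 2) => (x, z)) {0}ᶜ D := fun z hz => hD z hz
  have hlc : ContinuousOn (fun z : EuclideanSpace ℝ (Fin 2) => (x, z)) {0}ᶜ := by fun_prop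
  have hcf : ContinuousOn (fun z => f (x, z)) {0}ᶜ := hf.continuousOn.comp hlc hl
  have hcd : ContinuousOn (fun z => (metric f (x, z)).det) {0}ᶜ := by
    have hcg := fun i j => (hg i j).continuousOn.comp hlc hl
    simp only [Matrix.det_fin_two]
    exact ((hcg 0 0).mul (hcg 1 1)).sub ((hcg 0 1).mul (hcg 1 0))
  have hsub : Metric.sphere (0 : EuclideanSpace ℝ (Fin 2)) 1 ⊆ {0}ᶜ := fun z hz h0 => by
    rw [mem_singleton_iff] at h0
    simp [h0] at hz
  obtain ⟨m, hm, hmin⟩ := (isCompact_sphere (0 : EuclideanSpace ℝ (Fin 2)) 1).exists_isMinOn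
    (NormedSpace.sphere_nonempty.2 zero_le_one) (hcf.mono hsub)
  have hm0 : m ≠ 0 := hsub hm
  have hm1 : ‖m‖ = 1 := by simpa using hm
  have hfm := hpos m hm0
  -- Homogeneity carries the minimum on the unit circle to a bound on the whole punctured fibre.
  have hmin' : ∀ z, z ≠ 0 → f (x, m) ^ 2 * ‖z‖ ^ 2 ≤ f (x, z) ^ 2 := fun z hz => by
    have hz' := norm_pos_iff.2 hz
    have h1 : f (x, m) ≤ f (x, ‖z‖⁻¹ • z) := hmin (by
      simp [norm_smul, hz'.ne'])
    rw [hom z hz _ (inv_pos.2 hz'), ← div_eq_inv_mul, le_div_iff₀ hz'] at h1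
    rw [← mul_pow]
    exact pow_le_pow_left₀ (by positivity) h1 2
  have hc : 0 < f (x, m) ^ 2 := by positivity
  have hdm : 0 < (metric f (x, m)).det := by
    have key := fun v => metric_ge_of_isMin hf x m v hD hm1 hmin'
    have hn : ∀ z : EuclideanSpace ℝ (Fin 2), ‖z‖ ^ 2 = z 0 ^ 2 + z 1 ^ 2 := fun z => by
      simp [EuclideanSpace.norm_sq_eq]
    have hs : metric f (x, m) 1 0 = metric f (x, m) 0 1 := by
      have r := ((restricts_restrict hE).dY 0).dY 1
      rw [show partialY D 1 (partialY D 0 _) = partialY D 0 (partialY D 1 _) from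
        dirDeriv_comm _ _ _] at r
      exact r.apply_eq (((restricts_restrict hE).dY 1).dY 0) _ (hD m hm0)
    have k1 := key !₂[1, 0]
    -- On the vector (-g₀₁, g₀₀) the quadratic form equals g₀₀ det g, while (1, 0) gives g₀₀ > 0.
    have k2 := key !₂[-metric f (x, m) 0 1, metric f (x, m) 0 0]
    rw [hn] at k1 k2
    simp [hs] at k1 k2
    rw [Matrix.det_fin_two, hs]
    have g0 : 0 < metric f (x, m) 0 0 := hc.trans_le k1
    have g1 : 0 < f (x, m) ^ 2 * (metric f (x, m) 0 1 ^ 2 + metric f (x, m) 0 0 ^ 2) := by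
      positivity
    refine pos_of_mul_pos_right (a := metric f (x, m) 0 0) ?_ g0.le
    linarith
  by_contra! hneg
  -- A nonpositive value at y and a positive one at m would force a zero of det g on the punctured
  -- plane.
  have hconn : IsPreconnected ({0}ᶜ : Set (EuclideanSpace ℝ (Fin 2))) :=
    (isConnected_compl_singleton_of_one_lt_rank (by
      rw [← Module.finrank_eq_rank]; simp) 0).isPreconnected
  obtain ⟨z, hz, hz0⟩ := hconn.intermediate_value hy hm0 hcd ⟨hneg, hdm.le⟩
  exact hdet z hz hz0

end Convexity

/-! ### Coordinate expressions in a chart. -/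

section Charts

open Set Bundle

variable {n : ℕ} {M : Type*} [TopologicalSpace M] [ChartedSpace (EuclideanSpace ℝ (Fin n)) M]
  [IsManifold (𝓡 n) ∞ M] {F : TangentBundle (𝓡 n) M → ℝ}
  {e : OpenPartialHomeomorph M (EuclideanSpace ℝ (Fin n))}

omit [ChartedSpace (EuclideanSpace ℝ (Fin n)) M] [IsManifold (𝓡 n) ∞ M] in
lemma isOpen_slitDomain (e : OpenPartialHomeomorph M (EuclideanSpace ℝ (Fin n))) :
    IsOpen (slitDomain e) :=
  (e.open_target.preimage continuous_fst).inter (isOpen_ne.preimage continuous_snd)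

omit [IsManifold (𝓡 n) ∞ M] in
lemma mfderiv_symm_ne_zero (he : e ∈ IsManifold.maximalAtlas (𝓡 n) ∞ M) (p : TCoord n)
    (hp : p ∈ slitDomain e) : mfderiv (𝓡 n) (𝓡 n) e.symm p.1 p.2 ≠ 0 := by
  have hd : e.MDifferentiable (𝓡 n) (𝓡 n) :=
    ⟨(contMDiffOn_of_mem_maximalAtlas he).mdifferentiableOn (by simp),
      (contMDiffOn_symm_of_mem_maximalAtlas he).mdifferentiableOn (by simp)⟩
  intro h0
  exact hp.2 (hd.symm.mfderiv_injective hp.1 (h0.trans (map_zero _).symm))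

/-- On the slit domain the coordinate expression is F composed with the tangent map of `e.symm`,
which avoids the zero section because the differential is injective. -/
lemma contDiffOn_inChart (hF : IsFinsler F) (he : e ∈ IsManifold.maximalAtlas (𝓡 n) ∞ M) :
    ContDiffOn ℝ ∞ (inChart F e) (slitDomain e) := by
  have h1 : IsManifold (𝓡 n) 1 M := IsManifold.of_le (n := ∞) (by norm_cast)
  have hT := (contMDiffOn_symm_of_mem_maximalAtlas he).contMDiffOn_tangentMapWithin
    (m := ∞) (by simp) e.open_target.uniqueMDiffOn
  let S : TCoord n → TangentBundle (𝓡 n) (EuclideanSpace ℝ (Fin n)) := fun p => ⟨p.1, p.2⟩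
  have hS : ContMDiff 𝓘(ℝ, TCoord n) (𝓡 n).tangent ∞ S := by
    rw [modelWithCornersSelf_prod]
    exact contMDiff_tangentBundleModelSpaceHomeomorph_symm (I := 𝓡 n)
  have hw : ∀ p ∈ slitDomain e, tangentMapWithin (𝓡 n) (𝓡 n) e.symm e.target (S p) =
      ⟨e.symm p.1, mfderiv (𝓡 n) (𝓡 n) e.symm p.1 p.2⟩ := fun p hp => by
    simp only [tangentMapWithin, S]
    rw [mfderivWithin_of_isOpen e.open_target hp.1]
  have hTS := hT.comp (hS.contMDiffOn (s := slitDomain e)) fun p hp => hp.1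
  have hc := hF.smooth.comp hTS fun p hp => by
    rw [mem_preimage, Function.comp_apply, hw p hp]
    exact mfderiv_symm_ne_zero he p hp
  refine (contMDiffOn_iff_contDiffOn.1 hc).congr fun p hp => ?_
  rw [Function.comp_apply, Function.comp_apply, hw p hp]
  rfl

end Charts

/-! ### The curvature factor, β, and the passage to a chart of the surface. -/

section Surfaces

open TopologicalSpace

lemma lieD_congr {n : ℕ} {X : TCoord n → TCoord n} {φ ψ : TCoord n → ℝ} {U : Set (TCoord n)}
    (hU : IsOpen U) (h : Set.EqOn φ ψ U) : Set.EqOn (lieD X φ) (lieD X ψ) U := fun p hp => by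
  simp only [lieD, (h.eventuallyEq_of_mem (hU.mem_nhds hp)).fderiv_eq]

/-- The constant c is 1 for K₀ = K exp(A) and -1 for K = K₀ exp(-A). -/
lemma lieD_mul_exp {n : ℕ} (X : TCoord n → TCoord n) {φ A : TCoord n → ℝ} {p : TCoord n}
    (hφ : DifferentiableAt ℝ φ p) (hA : DifferentiableAt ℝ A p) (c : ℝ) :
    lieD X (fun q => φ q * Real.exp (c * A q)) p =
      (lieD X φ p + c * φ p * lieD X A p) * Real.exp (c * A p) := by
  have h := hφ.hasFDerivAt.mul (hA.hasFDerivAt.const_mul c).exp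
  simp only [lieD]
  rw [show (fun q => φ q * Real.exp (c * A q)) = φ * fun q => Real.exp (c * A q) from rfl, h.fderiv]
  simp
  ring

variable {f : TCoord 2 → ℝ} {D : Opens (TCoord 2)}

lemma IsFinslerOn.contDiffOn_frameV (h : IsFinslerOn f D) : ContDiffOn ℝ ∞ (frameV f) D :=
  contDiffOn_const.prodMk <| (contDiffOn_euclidean (n := ∞)).2 fun i =>
    (h.restricts_u i).contDiffOn

/-- The curvature of a Landsberg surface is `K₀ exp(-A)` with `V(K₀) = 0`. -/
lemma IsFinslerOn.exists_isCurvatureFactor (h : IsFinslerOn f D)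
    (hL : ∀ p ∈ D, ∀ i j k, landsbergTensor f i j k p = 0) {U : Set (TCoord 2)} (hUD : U ⊆ D)
    (hU : IsOpen U) {A : TCoord 2 → ℝ} (hA : IsIntegralAlong (frameV f) (mainScalar f) A U) :
    ∃ K₀ : TCoord 2 → ℝ, IsCurvatureFactor f A K₀ U := by
  have hK := h.restricts_K.contDiffOn.mono hUD
  refine ⟨fun p => flagCurvature f p * Real.exp (1 * A p), ?_, fun p hp => ?_, fun p hp => ?_⟩
  · exact hK.mul (contDiffOn_const.mul hA.smooth).exp
  · have hAp := (hA.smooth.contDiffAt (hU.mem_nhds hp)).differentiableAt (by simp)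
    rw [lieD_mul_exp _ (h.restricts_K.differentiableAt ⟨p, hUD hp⟩) hAp,
      h.lieD_frameV_flagCurvature hL p (hUD hp), hA.lieD_eq hU
        ((h.contDiffOn_frameV.mono hUD).of_le (by norm_cast))
        (h.restricts_I.contDiffOn.continuousOn.mono hUD) p hp]
    ring
  · simp only [one_mul]
    rw [mul_assoc, ← Real.exp_add, add_neg_cancel, Real.exp_zero, mul_one]

lemma IsCurvatureFactor.ne_zero {A K₀ : TCoord 2 → ℝ} {U : Set (TCoord 2)}
    (hK₀ : IsCurvatureFactor f A K₀ U) (hK : ∀ p ∈ U, flagCurvature f p ≠ 0) {p : TCoord 2}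
    (hp : p ∈ U) : K₀ p ≠ 0 := fun h0 => hK p hp (by rw [hK₀.curvature_eq p hp, h0, zero_mul])

/-- `β` is the logarithmic derivative of the flag curvature along the spray. -/
lemma IsCurvatureFactor.beta_eq {A K₀ : TCoord 2 → ℝ} {U : Set (TCoord 2)}
    (hK₀ : IsCurvatureFactor f A K₀ U) (hU : IsOpen U) (hA : ContDiffOn ℝ ∞ A U)
    (hK : ∀ p ∈ U, flagCurvature f p ≠ 0) : Set.EqOn (beta f A K₀)
      (fun p => lieD (spray f) (flagCurvature f) p * (flagCurvature f p)⁻¹) U := fun p hp => by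
  have e : Set.EqOn (flagCurvature f) (fun q => K₀ q * Real.exp (-1 * A q)) U := fun q hq => by
    simp only [neg_mul, one_mul, hK₀.curvature_eq q hq]
  have h0 := hK₀.ne_zero hK hp
  have hd := lieD_mul_exp (spray f)
    ((hK₀.smooth.contDiffAt (hU.mem_nhds hp)).differentiableAt (by simp))
    ((hA.contDiffAt (hU.mem_nhds hp)).differentiableAt (by simp)) (-1)
  simp only [beta]
  rw [lieD_congr hU e hp, hd, e hp]
  have := Real.exp_ne_zero (-1 * A p)
  field_simp
  ring

lemma inChart_homogeneous {M : Type*} [TopologicalSpace M]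
    [ChartedSpace (EuclideanSpace ℝ (Fin 2)) M] [IsManifold (𝓡 2) ∞ M]
    {F : TangentBundle (𝓡 2) M → ℝ} (hF : IsFinsler F)
    (e : OpenPartialHomeomorph M (EuclideanSpace ℝ (Fin 2))) (p : TCoord 2) (c : ℝ) (hc : 0 < c) :
    inChart F e (p.1, c • p.2) = c * inChart F e p := by
  simp only [inChart]
  rw [← hF.homogeneous _ _ c hc]
  congr 2
  exact map_smul _ c p.2

/-- The coordinate expression of a Finsler function of a surface. -/
lemma isFinslerOn_inChart {M : Type*} [TopologicalSpace M]
    [ChartedSpace (EuclideanSpace ℝ (Fin 2)) M] [IsManifold (𝓡 2) ∞ M]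
    {F : TangentBundle (𝓡 2) M → ℝ} (hF : IsFinsler F)
    {e : OpenPartialHomeomorph M (EuclideanSpace ℝ (Fin 2))}
    (he : e ∈ IsManifold.maximalAtlas (𝓡 2) ∞ M) :
    IsFinslerOn (inChart F e) ⟨slitDomain e, isOpen_slitDomain e⟩ where
  smooth := contDiffOn_inChart hF he
  pos p hp := hF.pos _ (mfderiv_symm_ne_zero he p hp)
  euler p hp := euler_of_homogeneous (D := ⟨slitDomain e, isOpen_slitDomain e⟩)
    (contDiffOn_inChart hF he) p hp (inChart_homogeneous hF e p)
  det_pos p hp := det_metric_pos (D := ⟨slitDomain e, isOpen_slitDomain e⟩)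
    (contDiffOn_inChart hF he) p.1 (fun _ hz => ⟨hp.1, hz⟩)
    (fun z hz => hF.pos _ (mfderiv_symm_ne_zero he (p.1, z) ⟨hp.1, hz⟩))
    (fun z _ => inChart_homogeneous hF e (p.1, z))
    (fun z hz => hF.nondegenerate e he (p.1, z) ⟨hp.1, hz⟩) p.2 hp.2

end Surfaces

end Finsler

theorem mainTheorem7 {M : Type*} [TopologicalSpace M]
    [ChartedSpace (EuclideanSpace ℝ (Fin 2)) M] [IsManifold (𝓡 2) ∞ M]
    (F : TangentBundle (𝓡 2) M → ℝ) (hF : Finsler.IsFinsler F) (hL : Finsler.IsLandsberg F)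
    (hK : Finsler.HasNonvanishingCurvature F)
    (e : OpenPartialHomeomorph M (EuclideanSpace ℝ (Fin 2)))
    (he : e ∈ IsManifold.maximalAtlas (𝓡 2) ∞ M)
    (f : Finsler.TCoord 2 → ℝ) (hf : f = Finsler.inChart F e) :
    -- the Jacobi endomorphism is `K (F² J - F d_J F ⊗ C)`
    (∀ p ∈ Finsler.slitDomain e, ∀ i j : Fin 2,
      Finsler.jacobiEndo f i j p = Finsler.flagCurvature f p *
        (f p ^ 2 * (if i = j then 1 else 0) - f p * Finsler.dY j f p * p.2 i)) ∧
    -- the integral of `I` along `V` exists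
    (∃ A : Finsler.TCoord 2 → ℝ, Finsler.IsIntegralAlong (Finsler.frameV f)
      (Finsler.mainScalar f) A (Finsler.slitDomain e)) ∧
    ∀ U ⊆ Finsler.slitDomain e, IsOpen U → ∀ A : Finsler.TCoord 2 → ℝ,
      Finsler.IsIntegralAlong (Finsler.frameV f) (Finsler.mainScalar f) A U →
      -- `K = K₀ exp(-∫ I)` with `V(K₀) = 0`
      (∃ K₀ : Finsler.TCoord 2 → ℝ, Finsler.IsCurvatureFactor f A K₀ U) ∧
      ∀ K₀ : Finsler.TCoord 2 → ℝ, Finsler.IsCurvatureFactor f A K₀ U →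
        ∀ p ∈ U, K₀ p ≠ 0 ∧
          Finsler.beta f A K₀ p
            + Finsler.mainScalar f p * Finsler.lieD (Finsler.frameV f) (Finsler.beta f A K₀) p
            + Finsler.lieD (Finsler.frameH f) (Finsler.mainScalar f) p
            + Finsler.lieD (Finsler.frameV f)
                (Finsler.lieD (Finsler.frameV f) (Finsler.beta f A K₀)) p = 0 := by
  subst hf
  have h := Finsler.isFinslerOn_inChart hF he
  have hL' := hL e he
  -- The witness left implicit is log √det g.
  refine ⟨fun p hp => h.jacobiEndo_eq p hp, ⟨_, Finsler.isIntegralAlong_of_lieD_eq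
    (Finsler.isOpen_slitDomain e) h.contDiffOn_log_det h.restricts_I.contDiffOn.continuousOn
    h.lieD_frameV_log_det⟩, fun U hUD hU A hA =>
    ⟨h.exists_isCurvatureFactor hL' hUD hU hA, fun K₀ hK₀ p hp => ?_⟩⟩
  have hKU := fun q hq => hK e he q (hUD hq)
  have hβ := hK₀.beta_eq hU hA.smooth hKU
  refine ⟨hK₀.ne_zero hKU hp, ?_⟩
  -- On the open set U, β and its derivatives may be replaced by those of S(K)/K, which removes A
  -- and K₀.
  have hV := Finsler.lieD_congr (X := Finsler.frameV (Finsler.inChart F e)) hU hβ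
  rw [hβ hp, hV hp, Finsler.lieD_congr hU hV hp]
  exact h.logDeriv_flagCurvature_identity hL' (hK e he) p (hUD hp)
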